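/- Let $k\ge 2$, let $X_1,\dots,X_k$ be non-empty sets and $f\colon X_1\times\dots\times X_k\to Y$. *Game.* In the generalized Ulam game $\mathcal G\langle f,q,l\rangle$ Paul adaptively asks at most $q$ questions of the form "does $x_i\in F$?" ($F\subseteq X_i$). Carole answers so that at least one tuple $x$ satisfies all but at most $l$ of the answers. Paul wins if, at the end, exactly one value of $f$ is possible. A strategy of Paul is a binary tree whose internal nodes are labelled with questions $(i,F)$ and whose leaves are labelled with values of $f$. It wins if, for every admissible play, the label of the leaf reached is the only possible value. It is semi-static of depth $q'$ if all its leaves are at depth $q'$ and all questions at the same depth have the same index $i$. *Protocols.* In a $k$-processor protocol, in each time step one processor sends one bit to another one. The sender and the receiver are determined by all the bits received so far. The bit sent by processor $P_i$ depends on $x_i$ and on what $P_i$ has observed. At the end $P_i$ outputs a value depending on $x_i$ and on its observations. The channel may invert bits. The protocol computes $f$ and is proof against $l$ errors (against a fraction $\varepsilon$ of errors) if, in every run in which at most $l$ bits (at most the fraction $\varepsilon$ of the exchanged bits) are inverted, all processors output $f(x_1,\dots,x_k)$. *Theorem.* 1. For every $l\ge 0$: Paul has a winning strategy in $\mathcal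 G\langle f,q,l\rangle$ for some $q$ if and only if there is a $k$-processor protocol, with a bounded number of exchanged bits, that computes $f$ and is proof against $l$ errors. 2. If a protocol computing $f$ exchanges at most $q$ bits in every run and is proof against $l$ errors, then Paul has a winning strategy in $\mathcal G\langle f,q,l\rangle$. 3. If Paul has a winning strategy in $\mathcal G\langle f,q,l\rangle$, then there are a semi-static strategy of some depth $q'\le kq$ that is winning against $l$ lies and a binary tree code of depth $q'$ with distance parameter $\frac12$ over the alphabet of $4$-bit letters. Moreover, for all such strategies $T$ and tree codes $S$ the following protocol exchanges at most $k(4k-3)q$ bits, has a fixed schedule, computes $f$, and is proof against $\lfloor l/4\rfloor$ errors and against the fraction $$\frac{l}{4k(4k-3)q}$$ of errors (read as $0$ if $q=0$, when no bits are exchanged). There are $q'$ rounds. In the round at depth $d$, whose questions have index $i$, processor $P_i$ (if $i\ne1$) sends to $P_1$ the one-bit answer to the question at the node of $T$ that it takes for the state of $P_1$. Processor $P_1$ moves from its state to the son given by the received bit (by its own true answer if $i=1$), and sends the $4$-bit letter $S$ on the arc to its new state to every other processor. The other processors determine the state of $P_1$ by minimum Hamming distance decoding of the letters they have received. When the leaves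 are reached, every processor outputs the label of the leaf that is its state. Here a labelling of the arcs of the binary tree of depth $n$ is a tree code with distance parameter $\alpha$ if, for any two nodes $u,v$ at the same depth $h\le n$ whose least common ancestor is at depth $h-m$, the words on the two paths of length $m$ from this ancestor to $u$ and $v$ differ in at least $\alpha m$ positions. -/

import Mathlib

universe u v

namespace UlamGame

/-! ### The generalized Ulam game -/

/-- A strategy tree of Paul. An internal node carries the question "does `x i ∈ F`?" and has a son
for the answer "no" and a son for the answer "yes"; a leaf carries a value of the function. -/
inductive StrategyTree {k : ℕ} (X : Fin k → Type u) (Y : Type v) : Type (max u v)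
  | leaf (y : Y) : StrategyTree X Y
  | node (i : Fin k) (F : Set (X i)) (no yes : StrategyTree X Y) : StrategyTree X Y

namespace StrategyTree

variable {k : ℕ} {X : Fin k → Type u} {Y : Type v}

/-- The largest number of questions that are asked on a branch of the tree. -/
def depth : StrategyTree X Y → ℕ
  | leaf _ => 0
  | node _ _ no yes => max no.depth yes.depth + 1

/-- The label of the leaf that is reached when the answer to the question number `m`
(counted from `0`) is `a m`, where `true` means "yes". -/
def value : StrategyTree X Y → (ℕ → Bool) → Y
  | leaf y, _ => y
  | node _ _ no yes, a =>
    if a 0 = true then yes.value (fun m => a (m + 1)) else no.value (fun m => a (m + 1))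

open Classical in
/-- The number of questions on the branch described by the answers `a` whose answer is false for
the tuple `x`. -/
noncomputable def lies : StrategyTree X Y → (∀ i, X i) → (ℕ → Bool) → ℕ
  | leaf _, _, _ => 0
  | node i F no yes, x, a =>
    (if (a 0 = true ↔ x i ∈ F) then 0 else 1) +
      (if a 0 = true then yes.lies x (fun m => a (m + 1)) else no.lies x (fun m => a (m + 1)))

/-- The values of `f` that are still possible at the end of the play with the answers `a`, when at
most `l` answers are lies. -/
def possibleValues (T : StrategyTree X Y) (f : (∀ i, X i) → Y) (l : ℕ) (a : ℕ → Bool) : Set Y :=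
  {y | ∃ x, T.lies x a ≤ l ∧ f x = y}

/-- The strategy is winning against `l` lies: whenever Carole's answers are admissible (some tuple
satisfies all of them with at most `l` exceptions), exactly one value of `f` is possible at
the end, and it is the one at the leaf. -/
def Wins (T : StrategyTree X Y) (f : (∀ i, X i) → Y) (l : ℕ) : Prop :=
  ∀ a : ℕ → Bool, (∃ x, T.lies x a ≤ l) → T.possibleValues f l a = {T.value a}

/-- The tree is semi-static with the list `idx` of indices: all leaves are at depth `idx.length`,
and all questions at depth `d` concern the coordinate `idx[d]`. -/
def IsSemiStatic : StrategyTree X Y → List (Fin k) → Prop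
  | leaf _, [] => True
  | node i _ no yes, j :: idx => i = j ∧ no.IsSemiStatic idx ∧ yes.IsSemiStatic idx
  | _, _ => False

open Classical in
/-- The true answer to the question at the node `w` (the list of the answers on the way from the
root to the node), computed by the processor `j` from its input; it is a dummy when that
question is not about the input of `j`. -/
noncomputable def answer (j : Fin k) (x : X j) : StrategyTree X Y → List Bool → Bool
  | leaf _, _ => false
  | node i F _ _, [] => if h : j = i then decide (h ▸ x ∈ F) else false
  | node _ _ no _, false :: w => no.answer j x w
  | node _ _ _ yes, true :: w => yes.answer j x w

open Classical in
/-- The branch that processor `c` follows: it answers the questions about its own input `x`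
itself, and takes the answers to the other questions from the list of bits that it has received.
The branch ends when these are used up. -/
noncomputable def track (c : Fin k) (x : X c) : StrategyTree X Y → List Bool → List Bool
  | leaf _, _ => []
  | node i F no yes, bits =>
    if h : c = i then
      if h ▸ x ∈ F then true :: yes.track c x bits else false :: no.track c x bits
    else
      match bits with
      | [] => []
      | true :: bits => true :: yes.track c x bits
      | false :: bits => false :: no.track c x bits

end StrategyTree

/-- Paul has a winning strategy in the game with the function `f`, at most `q` questions and at
most `l` lies. -/
def PaulWins {k : ℕ} {X : Fin k → Type u} {Y : Type v} (f : (∀ i, X i) → Y) (q l : ℕ) : Prop :=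
  ∃ T : StrategyTree X Y, T.depth ≤ q ∧ T.Wins f l

/-! ### Protocols over noisy channels -/

/-- What a processor observes in one time step: nothing, that it sends a bit to `receiver`, or that
it receives the bit `b` from `sender`. -/
inductive Observation (k : ℕ) : Type
  | idle : Observation k
  | sent (receiver : Fin k) : Observation k
  | received (sender : Fin k) (b : Bool) : Observation k

/-- The observation of processor `i` in a step in which the first processor of the pair sends
a bit to the second one, and `b` is the bit received. -/
def observe {k : ℕ} (i : Fin k) : Option (Fin k × Fin k) → Bool → Observation k
  | none, _ => .idle
  | some (s, r), b => if i = s then .sent r else if i = r then .received s b else .idle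

/-- A `k`-processor protocol, in which in every time step one processor sends one bit to another
one. A trace is the list of the bits received so far (by all processors).
* `next τ` is the pair (sender, receiver) of the next step after the trace `τ`, or `none` if the
  communication has ended.
* `msg i x w j` is the bit that `i` sends to `j`, given its input `x` and its observations `w`.
* `out i x w` is the value computed by `i` at the end from its input and its observations. -/
structure Protocol {k : ℕ} (X : Fin k → Type u) (Y : Type v) where
  next : List Bool → Option (Fin k × Fin k)
  next_ne : ∀ τ i j, next τ = some (i, j) → i ≠ j
  msg : ∀ i : Fin k, X i → List (Observation k) → Fin k → Bool
  out : ∀ i : Fin k, X i → List (Observation k) → Y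

namespace Protocol

variable {k : ℕ} {X : Fin k → Type u} {Y : Type v}

/-- The observations of processor `i` in the steps of the trace `τ`. -/
def view (P : Protocol X Y) (i : Fin k) (τ : List Bool) : List (Observation k) :=
  (List.range τ.length).map fun t => observe i (P.next (τ.take t)) (τ.getD t false)

/-- The trace after (at most) `n` steps on the input `x`, where `e t` tells whether the channel
inverts the bit transmitted in step `t`. -/
def trace (P : Protocol X Y) (x : ∀ i, X i) (e : ℕ → Bool) : ℕ → List Bool
  | 0 => []
  | n + 1 =>
    match P.next (P.trace x e n) with
    | none => P.trace x e n
    | some (i, j) =>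
      P.trace x e n ++ [xor (P.msg i (x i) (P.view i (P.trace x e n)) j) (e n)]

/-- The run on the input `x` with the noise `e` ends after at most `n` bits. -/
def Halts (P : Protocol X Y) (x : ∀ i, X i) (e : ℕ → Bool) (n : ℕ) : Prop :=
  P.next (P.trace x e n) = none

/-- The number of incorrectly transmitted bits in the first `n` steps. -/
def errors (P : Protocol X Y) (x : ∀ i, X i) (e : ℕ → Bool) (n : ℕ) : ℕ :=
  ((Finset.range (P.trace x e n).length).filter fun t => e t = true).card

/-- Every run of the protocol exchanges at most `n` bits. -/
def ExchangesAtMost (P : Protocol X Y) (n : ℕ) : Prop :=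
  ∀ x e, P.Halts x e n

/-- At the end of the run all processors have computed `f x`. -/
def Correct (P : Protocol X Y) (f : (∀ i, X i) → Y) (x : ∀ i, X i) (e : ℕ → Bool) (n : ℕ) : Prop :=
  ∀ i, P.out i (x i) (P.view i (P.trace x e n)) = f x

/-- The protocol computes `f` whenever at most `l` bits are incorrectly transmitted. -/
def ProofAgainst (P : Protocol X Y) (f : (∀ i, X i) → Y) (l : ℕ) : Prop :=
  ∀ x e n, P.Halts x e n → P.errors x e n ≤ l → P.Correct f x e n

/-- The protocol computes `f` whenever the fraction of incorrectly transmitted bits is at most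
`ε`. -/
def ProofAgainstFraction (P : Protocol X Y) (f : (∀ i, X i) → Y) (ε : ℝ) : Prop :=
  ∀ x e n, P.Halts x e n → (P.errors x e n : ℝ) ≤ ε * ((P.trace x e n).length : ℝ) →
    P.Correct f x e n

/-- The sender and the receiver of a step depend only on the number of the step. -/
def FixedSchedule (P : Protocol X Y) : Prop :=
  ∀ τ τ' : List Bool, τ.length = τ'.length → P.next τ = P.next τ'

end Protocol

/-! ### Tree codes -/

/-- A labelling of the binary tree of depth `n` that is a tree code with distance parameter `α`.
A node is the list of the arcs from the root to it, and `C v` is the letter on the arc that leads to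
the node `v` from its parent (`C []` is not used). Below, `p` is the least common
ancestor of the nodes `p ++ u` and `p ++ v`. -/
def IsTreeCode {S : Type*} [DecidableEq S] (C : List Bool → S) (α : ℝ) (n : ℕ) : Prop :=
  ∀ p u v : List Bool, u.length = v.length → u.head? ≠ v.head? → p.length + u.length ≤ n →
    α * (u.length : ℝ) ≤
      (((Finset.range u.length).filter fun t =>
        C (p ++ u.take (t + 1)) ≠ C (p ++ v.take (t + 1))).card : ℝ)

/-- The letters of the 4-bit alphabet. -/
abbrev Letter : Type := Fin 4 → Bool

/-- The letter number `t` in a sequence of bits. -/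
def letterAt (bits : List Bool) (t : ℕ) : Letter := fun b => bits.getD (4 * t + (b : ℕ)) false

/-- The Hamming distance, in letters, between the first `m` letters on the branch `w` and the first
`m` letters of the sequence `bits`. -/
def codeDist (C : List Bool → Letter) (bits : List Bool) (m : ℕ) (w : List Bool) : ℕ :=
  ((Finset.range m).filter fun t => C (w.take (t + 1)) ≠ letterAt bits t).card

/-- Minimum distance decoding: a node at depth `bits.length / 4` such that the letters on the branch
leading to it have the least Hamming distance to the received letters. -/
noncomputable def decode (C : List Bool → Letter) (bits : List Bool) : List Bool :=
  Function.argminOn (codeDist C bits (bits.length / 4)) {w | w.length = bits.length / 4}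
    ⟨List.replicate (bits.length / 4) false, List.length_replicate⟩

/-! ### The protocol of a semi-static strategy and a tree code -/

/-- The bits received by a processor, in order. -/
def receivedBits {k : ℕ} (w : List (Observation k)) : List Bool :=
  w.filterMap fun o => match o with
    | .received _ b => some b
    | _ => none

/-- The number of bits already sent to `j`. -/
def numSent {k : ℕ} (j : Fin k) (w : List (Observation k)) : ℕ :=
  w.countP fun o => match o with
    | .sent r => decide (r = j)
    | _ => false

/-- The transmissions (sender, receiver) of a round in which a question about the input of processor
`i` is answered: `i` sends one bit to the central processor `c` (nothing if `i = c`), and then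
`c` sends four bits (one letter) to every other processor. -/
def roundSchedule {k : ℕ} (c i : Fin k) : List (Fin k × Fin k) :=
  (if i = c then [] else [(i, c)]) ++
    ((List.finRange k).filter fun j => j ≠ c).flatMap fun j => List.replicate 4 (c, j)

theorem ne_of_mem_roundSchedule {k : ℕ} (c i : Fin k) {s r : Fin k}
    (h : (s, r) ∈ roundSchedule c i) : s ≠ r := by
  simp only [roundSchedule, List.mem_append, List.mem_flatMap, List.mem_filter,
    List.mem_replicate] at h
  rcases h with h | ⟨j, ⟨_, hj⟩, _, h⟩
  · split_ifs at h with hi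
    · simp at h
    · simp only [List.mem_singleton, Prod.mk.injEq] at h
      rw [h.1, h.2]; exact hi
  · simp only [Prod.mk.injEq] at h
    rw [h.1, h.2]; exact fun h' => by simp [h'] at hj

/-- The protocol given by a semi-static strategy `T` with the list `idx` of indices, and a labelling
`C` of the strategy tree. There is one round for every entry of `idx`.
* The central processor `c` maintains its state (a node of `T`) by `track`. To each other
  processor it sends the letters on the branch leading to its state, bit by bit.
* Another processor decodes the bits received from `c` to a node of `T`; if it is its turn, it
  sends to `c` the true answer to the question at this node.
* At the end every processor returns the label of the leaf that is its state. -/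
noncomputable def treeCodeProtocol {k : ℕ} {X : Fin k → Type u} {Y : Type v}
    (c : Fin k) (T : StrategyTree X Y) (idx : List (Fin k)) (C : List Bool → Letter) :
    Protocol X Y where
  next τ := (idx.flatMap (roundSchedule c))[τ.length]?
  next_ne τ i j h := by
    obtain ⟨i', _, h'⟩ := List.mem_flatMap.1 (List.mem_of_getElem? h)
    exact ne_of_mem_roundSchedule c i' h'
  msg i x w j :=
    if h : i = c then
      C ((T.track c (h ▸ x) (receivedBits w)).take (numSent j w / 4 + 1))
        ⟨numSent j w % 4, Nat.mod_lt _ (by norm_num)⟩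
    else T.answer i x (decode C (receivedBits w))
  out i x w :=
    if h : i = c then
      T.value fun m => (T.track c (h ▸ x) (receivedBits w)).getD m false
    else T.value fun m => (decode C (receivedBits w)).getD m false

end UlamGame

/-! From a protocol to a strategy: Paul asks for the bits of the protocol. A tuple with at most `l`
lies in a play is an input on which at most `l` inversions produce the trace of that play. Two
tuples `x`, `x'` that both remain possible thus share a trace. Exchanging their coordinate 0
preserves the total number of lies (`lies_update_add_lies_update`), so one of the two mixed tuples
is possible as well. In its run processor 0 cannot tell it from one of the original inputs, nor
processor 1 from the other, which forces `f x = f x'`.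

From a strategy to a protocol: every question is padded to a block of `k` questions, which makes the
strategy semi-static, and a linear tree code is found by choosing its coefficients one after the
other so that a potential does not grow (`exists_totalWeight_le`). The heart is
`values_eq_of_errors_le`. The central processor never backtracks. An answer on its branch is a lie
only if the answer bit was inverted or the answering processor had decoded a wrong state. A wrong
decoding means that, for some `m`, at least a quarter of the last `m` letters are wrong, so wrong
decodings are at most four times as many as wrong letters (`card_bad_le_four_mul`). Hence `l / 4`
errors cause at most `l` lies, and the leaf has the right label. A branch decoded at the end may
leave the central one `m` arcs before the leaf. These arcs are paid for by the errors in the last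
`m` letters, which the common part of the branches does not need.

For the equivalence, repetition of questions turns a win against any number of lies into a win
against `4 * l` lies (`PaulWins.exists_of_any`). -/

namespace UlamGame

/-! ### Winning strategies and the number of lies -/

namespace StrategyTree

variable {k : ℕ} {X : Fin k → Type u} {Y : Type v}

theorem wins_iff {T : StrategyTree X Y} {f : (∀ i, X i) → Y} {l : ℕ} :
    T.Wins f l ↔ ∀ a x, T.lies x a ≤ l → T.value a = f x := by
  constructor
  · intro h a x hx
    have h1 := h a ⟨x, hx⟩
    have h2 : f x ∈ T.possibleValues f l a := ⟨x, hx, rfl⟩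
    rw [h1] at h2
    exact h2.symm
  · rintro h a ⟨x, hx⟩
    ext y
    constructor
    · rintro ⟨x', hx', rfl⟩
      exact (h a x' hx').symm
    · rintro rfl
      exact ⟨x, hx, (h a x hx).symm⟩

theorem Wins.mono {T : StrategyTree X Y} {f : (∀ i, X i) → Y} {l l' : ℕ} (h : T.Wins f l)
    (hl : l' ≤ l) : T.Wins f l' :=
  wins_iff.2 fun a x hx => wins_iff.1 h a x (hx.trans hl)

/-- The labels of the leaves can be chosen well as soon as the answers determine the value. -/
theorem exists_relabel_aux [∀ i, Nonempty (X i)] (f : (∀ i, X i) → Y) (l : ℕ)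
    (T : StrategyTree X Y) : ∀ c : (∀ i, X i) → ℕ,
    (∀ a x x', c x + T.lies x a ≤ l → c x' + T.lies x' a ≤ l → f x = f x') →
    ∃ T' : StrategyTree X Y, T'.depth = T.depth ∧
      ∀ a x, c x + T'.lies x a ≤ l → T'.value a = f x := by
  induction T with
  | leaf y =>
    intro c h
    -- Here `c x` is the number of lies for `x` on the way to this subtree. If no tuple is possible
    -- at the leaf, any label will do.
    by_cases hx : ∃ x, c x ≤ l
    · obtain ⟨x, hx⟩ := hx
      exact ⟨leaf (f x), rfl, fun a x' hx' => h a x x' hx hx'⟩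
    · refine ⟨leaf y, rfl, fun a x' hx' => (hx ⟨x', ?_⟩).elim⟩
      simpa [lies] using hx'
  | node i F no yes ihn ihy =>
    intro c h
    classical
    obtain ⟨n', hn, hn'⟩ := ihn (fun x => c x + if x i ∈ F then 1 else 0) (by
      intro a x x' hx hx'
      refine h (fun m => Nat.casesOn m false a) x x' ?_ ?_
      · simpa [lies, add_assoc] using hx
      · simpa [lies, add_assoc] using hx')
    obtain ⟨y', hy, hy'⟩ := ihy (fun x => c x + if x i ∈ F then 0 else 1) (by
      intro a x x' hx hx'
      refine h (fun m => Nat.casesOn m true a) x x' ?_ ?_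
      · simpa [lies, add_assoc] using hx
      · simpa [lies, add_assoc] using hx')
    refine ⟨node i F n' y', by simp [depth, hn, hy], fun a x hx => ?_⟩
    cases ha : a 0
    · simp only [value, ha]
      apply hn'
      simpa [lies, add_assoc, ha] using hx
    · simp only [value, ha]
      apply hy'
      simpa [lies, add_assoc, ha] using hx

/-- Lets the trees built below carry a dummy label at all leaves: only the information gathered by
the questions matters. -/
theorem exists_wins_of_determined [∀ i, Nonempty (X i)] (f : (∀ i, X i) → Y) (l : ℕ)
    (T : StrategyTree X Y)
    (h : ∀ a x x', T.lies x a ≤ l → T.lies x' a ≤ l → f x = f x') :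
    ∃ T' : StrategyTree X Y, T'.depth = T.depth ∧ T'.Wins f l := by
  obtain ⟨T', h1, h2⟩ := exists_relabel_aux f l T (fun _ => 0) (by simpa using h)
  exact ⟨T', h1, wins_iff.2 (by simpa using h2)⟩

/-- Exchanging one coordinate of two tuples preserves the total number of lies. -/
theorem lies_update_add_lies_update (T : StrategyTree X Y) (j : Fin k) (x x' : ∀ i, X i) :
    ∀ a, T.lies (Function.update x j (x' j)) a + T.lies (Function.update x' j (x j)) a =
      T.lies x a + T.lies x' a := by
  classical
  induction T with
  | leaf y => intro a; simp [lies]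
  | node i F no yes ihn ihy =>
    intro a
    have h1 := ihn fun m => a (m + 1)
    have h2 := ihy fun m => a (m + 1)
    simp only [lies]
    -- A question concerns one coordinate: the exchange swaps the contributions of the two tuples if
    -- this is `j`, and changes neither otherwise.
    by_cases hij : i = j
    · subst hij
      simp only [Function.update_self]
      cases a 0
      · simp only [Bool.false_eq_true, if_false]
        linarith
      · simp only [if_true]
        linarith
    · simp only [Function.update_of_ne hij]
      cases a 0
      · simp only [Bool.false_eq_true, if_false]
        linarith
      · simp only [if_true]
        linarith

/-! ### Asking questions repeatedly -/

/-- The tree in which Paul asks a fixed list of questions. -/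
def ofQuestions (y : Y) : List (Σ i, Set (X i)) → StrategyTree X Y
  | [] => leaf y
  | Q :: L => node Q.1 Q.2 (ofQuestions y L) (ofQuestions y L)

open Classical in
/-- The number of questions in a list that distinguish two tuples. -/
noncomputable def numDistinguishing (x x' : ∀ i, X i) (L : List (Σ i, Set (X i))) : ℕ :=
  L.countP fun Q => ¬ (x Q.1 ∈ Q.2 ↔ x' Q.1 ∈ Q.2)

open Classical in
theorem numDistinguishing_cons (x x' : ∀ i, X i) (Q : Σ i, Set (X i))
    (L : List (Σ i, Set (X i))) : numDistinguishing x x' (Q :: L) =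
      numDistinguishing x x' L + if (x Q.1 ∈ Q.2 ↔ x' Q.1 ∈ Q.2) then 0 else 1 := by
  rw [numDistinguishing, List.countP_cons]
  by_cases h : (x Q.1 ∈ Q.2 ↔ x' Q.1 ∈ Q.2) <;> simp [h, numDistinguishing]

/-- Either answer to a distinguishing question is a lie for one of the two tuples. -/
theorem numDistinguishing_le_lies_add_lies (y : Y) (x x' : ∀ i, X i)
    (L : List (Σ i, Set (X i))) : ∀ a,
    numDistinguishing x x' L ≤ (ofQuestions y L).lies x a + (ofQuestions y L).lies x' a := by
  classical
  induction L with
  | nil => intro a; simp [numDistinguishing]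
  | cons Q L ih =>
    intro a
    have := ih fun m => a (m + 1)
    rw [numDistinguishing_cons]
    simp only [ofQuestions, lies, ite_self]
    by_cases h1 : x Q.1 ∈ Q.2 <;> by_cases h2 : x' Q.1 ∈ Q.2 <;> cases a 0 <;>
      simp [h1, h2] <;> omega

/-- All questions of a tree. -/
def questions : StrategyTree X Y → List (Σ i, Set (X i))
  | leaf _ => []
  | node i F no yes => ⟨i, F⟩ :: (no.questions ++ yes.questions)

theorem exists_truthful (T : StrategyTree X Y) (x : ∀ i, X i) : ∃ a, ∀ x',
    (∀ Q ∈ T.questions, x Q.1 ∈ Q.2 ↔ x' Q.1 ∈ Q.2) → T.lies x' a = 0 := by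
  classical
  induction T with
  | leaf y => exact ⟨fun _ => false, fun _ _ => rfl⟩
  | node i F no yes ihn ihy =>
    obtain ⟨an, hn⟩ := ihn
    obtain ⟨ay, hy⟩ := ihy
    by_cases hx : x i ∈ F
    · refine ⟨fun m => Nat.casesOn m true ay, fun x' h => ?_⟩
      have h0 : x' i ∈ F := (h ⟨i, F⟩ (by simp [questions])).1 hx
      simpa [lies, h0] using hy x' fun Q hQ => h Q (by simp [questions, hQ])
    · refine ⟨fun m => Nat.casesOn m false an, fun x' h => ?_⟩
      have h0 : x' i ∉ F := fun h' => hx ((h ⟨i, F⟩ (by simp [questions])).2 h')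
      simpa [lies, h0] using hn x' fun Q hQ => h Q (by simp [questions, hQ])

end StrategyTree

open StrategyTree

/-- A win against zero lies already shows that `f` is determined by the answers to the finitely many
questions of the tree. Each of them is asked `2 * l' + 1` times: tuples that differ on one of them
cannot both have at most `l'` lies. -/
theorem PaulWins.exists_of_any {k : ℕ} {X : Fin k → Type u} {Y : Type v} [∀ i, Nonempty (X i)]
    {f : (∀ i, X i) → Y} {q l : ℕ} (h : PaulWins f q l) (l' : ℕ) : ∃ q', PaulWins f q' l' := by
  classical
  obtain ⟨T, -, hT⟩ := h
  have h0 := wins_iff.1 (hT.mono (Nat.zero_le l))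
  have y : Y := f fun i => Classical.arbitrary (X i)
  obtain ⟨T', -, hT'⟩ := exists_wins_of_determined f l'
    (ofQuestions y (T.questions.flatMap fun Q => List.replicate (2 * l' + 1) Q)) (by
      intro a x x' hx hx'
      have hd : ∀ Q ∈ T.questions, x Q.1 ∈ Q.2 ↔ x' Q.1 ∈ Q.2 := by
        by_contra! hcon
        obtain ⟨Q, hQ, hne⟩ := hcon
        have h1 := numDistinguishing_le_lies_add_lies y x x'
          (T.questions.flatMap fun Q => List.replicate (2 * l' + 1) Q) a
        have hsub : (List.replicate (2 * l' + 1) Q).Sublist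
            (T.questions.flatMap fun Q => List.replicate (2 * l' + 1) Q) := by
          simpa using (List.singleton_sublist.2 hQ).flatMap
            fun Q => List.replicate (2 * l' + 1) Q
        have h2 : 2 * l' + 1 ≤ numDistinguishing x x'
            (T.questions.flatMap fun Q => List.replicate (2 * l' + 1) Q) := by
          refine le_trans ?_ (hsub.countP_le)
          rw [List.countP_replicate, if_pos]
          simp only [decide_eq_true_eq]
          tauto
        omega
      obtain ⟨b, hb⟩ := exists_truthful T x
      rw [← h0 b x (hb x fun _ _ => Iff.rfl).le, ← h0 b x' (hb x' hd).le])
  exact ⟨_, T', le_rfl, hT'⟩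

/-! ### Semi-static strategies -/

namespace StrategyTree

variable {k : ℕ} {X : Fin k → Type u} {Y : Type v}

/-- Every play of `T'` simulates a play of `T` with at most as many lies. -/
def Refines (T' T : StrategyTree X Y) : Prop :=
  ∀ a', ∃ a, T'.value a' = T.value a ∧ ∀ x, T.lies x a ≤ T'.lies x a'

theorem Refines.refl (T : StrategyTree X Y) : T.Refines T := fun a => ⟨a, rfl, fun _ => le_rfl⟩

theorem Refines.wins {T' T : StrategyTree X Y} (h : T'.Refines T) {f : (∀ i, X i) → Y} {l : ℕ}
    (hT : T.Wins f l) : T'.Wins f l := by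
  refine wins_iff.2 fun a' x hx => ?_
  obtain ⟨a, h1, h2⟩ := h a'
  rw [h1]
  exact wins_iff.1 hT a x ((h2 x).trans hx)

theorem Refines.node {i : Fin k} {F : Set (X i)} {n' n y' y : StrategyTree X Y}
    (hn : n'.Refines n) (hy : y'.Refines y) : (node i F n' y').Refines (node i F n y) := by
  classical
  intro a'
  obtain ⟨an, hn1, hn2⟩ := hn fun m => a' (m + 1)
  obtain ⟨ay, hy1, hy2⟩ := hy fun m => a' (m + 1)
  cases ha : a' 0
  · refine ⟨fun m => Nat.casesOn m false an, by simp [value, ha, hn1], fun x => ?_⟩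
    refine Nat.add_le_add (le_of_eq ?_) ?_
    · change (if ((false : Bool) = true ↔ x i ∈ F) then 0 else 1) = _
      rw [ha]
    · simpa [ha] using hn2 x
  · refine ⟨fun m => Nat.casesOn m true ay, by simp [value, ha, hy1], fun x => ?_⟩
    refine Nat.add_le_add (le_of_eq ?_) ?_
    · change (if ((true : Bool) = true ↔ x i ∈ F) then 0 else 1) = _
      rw [ha]
    · simpa [ha] using hy2 x

/-- Questions whose answers are ignored can be put in front of a strategy. -/
theorem Refines.exists_prepend {T' T : StrategyTree X Y} {idx : List (Fin k)}
    (h : T'.Refines T) (hs : T'.IsSemiStatic idx) (L : List (Fin k)) :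
    ∃ T'' : StrategyTree X Y, T''.Refines T ∧ T''.IsSemiStatic (L ++ idx) := by
  induction L with
  | nil => exact ⟨T', h, hs⟩
  | cons j L ih =>
    obtain ⟨T'', h1, h2⟩ := ih
    -- Both sons are the same tree, so the answer has no effect except perhaps one more lie.
    refine ⟨StrategyTree.node j Set.univ T'' T'', fun a' => ?_, rfl, h2, h2⟩
    obtain ⟨a, ha1, ha2⟩ := h1 fun m => a' (m + 1)
    refine ⟨a, by simpa [value] using ha1, fun x => (ha2 x).trans ?_⟩
    simp [lies]

/-- Each question becomes a block running through all `k` indices, in which only the entry with the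
right index is used. Branches that end early are filled up with ignored questions. -/
theorem exists_semiStatic (q : ℕ) : ∀ T : StrategyTree X Y, T.depth ≤ q →
    ∃ T' : StrategyTree X Y, T'.Refines T ∧
      T'.IsSemiStatic (List.replicate q (List.finRange k)).flatten := by
  induction q with
  | zero =>
    intro T hT
    cases T with
    | leaf y => exact ⟨leaf y, Refines.refl _, trivial⟩
    | node i F no yes => simp [depth] at hT
  | succ q ih =>
    intro T hT
    rw [List.replicate_succ, List.flatten_cons]
    cases T with
    | leaf y =>
      obtain ⟨T', h1, h2⟩ := ih (leaf y) (Nat.zero_le _)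
      exact h1.exists_prepend h2 _
    | node i F no yes =>
      simp only [depth, add_le_add_iff_right, sup_le_iff] at hT
      obtain ⟨n', hn1, hn2⟩ := ih no hT.1
      obtain ⟨y', hy1, hy2⟩ := ih yes hT.2
      obtain ⟨L₁, L₂, hL⟩ := List.append_of_mem (List.mem_finRange i)
      obtain ⟨n'', hn3, hn4⟩ := hn1.exists_prepend hn2 L₂
      obtain ⟨y'', hy3, hy4⟩ := hy1.exists_prepend hy2 L₂
      have hs : (node i F n'' y'').IsSemiStatic
          (i :: (L₂ ++ (List.replicate q (List.finRange k)).flatten)) := ⟨rfl, hn4, hy4⟩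
      obtain ⟨T', h1, h2⟩ := (hn3.node (F := F) hy3).exists_prepend hs L₁
      refine ⟨T', h1, ?_⟩
      rw [← List.cons_append, ← List.append_assoc, ← hL] at h2
      exact h2

end StrategyTree

/-! ### From a protocol to a strategy -/

namespace Protocol

variable {k : ℕ} {X : Fin k → Type u} {Y : Type v}

/-- The tree that asks for the bits exchanged in the next `n` steps after the trace `τ`. -/
def toTree (P : Protocol X Y) (y : Y) : ℕ → List Bool → StrategyTree X Y
  | 0, _ => .leaf y
  | n + 1, τ =>
    match P.next τ with
    | none => .leaf y
    | some (i, j) => .node i {x | P.msg i x (P.view i τ) j = true}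
        (P.toTree y n (τ ++ [false])) (P.toTree y n (τ ++ [true]))

theorem depth_toTree_le (P : Protocol X Y) (y : Y) (n : ℕ) :
    ∀ τ, (P.toTree y n τ).depth ≤ n := by
  induction n with
  | zero => intro τ; simp [toTree, StrategyTree.depth]
  | succ n ih =>
    intro τ
    rw [toTree]
    split
    · simp [StrategyTree.depth]
    · simp [StrategyTree.depth, ih]

/-- The trace in which the bits are given by `a`. -/
def answerTrace (P : Protocol X Y) (a : ℕ → Bool) : ℕ → List Bool
  | 0 => []
  | n + 1 =>
    match P.next (P.answerTrace a n) with
    | none => P.answerTrace a n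
    | some _ => P.answerTrace a n ++ [a n]

/-- The noise that turns the run on `x` into the trace given by `a`. -/
def noise (P : Protocol X Y) (a : ℕ → Bool) (x : ∀ i, X i) (n : ℕ) : Bool :=
  match P.next (P.answerTrace a n) with
  | none => false
  | some (i, j) => xor (P.msg i (x i) (P.view i (P.answerTrace a n)) j) (a n)

theorem trace_noise (P : Protocol X Y) (a : ℕ → Bool) (x : ∀ i, X i) (n : ℕ) :
    P.trace x (P.noise a x) n = P.answerTrace a n := by
  induction n with
  | zero => rfl
  | succ n ih =>
    rw [trace, answerTrace, ih]
    rcases h : P.next (P.answerTrace a n) with _ | ⟨i, j⟩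
    · rfl
    · simp [noise, h]

theorem length_answerTrace_le (P : Protocol X Y) (a : ℕ → Bool) (n : ℕ) :
    (P.answerTrace a n).length ≤ n := by
  induction n with
  | zero => simp [answerTrace]
  | succ n ih =>
    rw [answerTrace]
    split
    · omega
    · simpa using ih

theorem answerTrace_of_next_eq_none (P : Protocol X Y) (a : ℕ → Bool) {m : ℕ}
    (h : P.next (P.answerTrace a m) = none) (n : ℕ) :
    P.answerTrace a (m + n) = P.answerTrace a m := by
  induction n with
  | zero => rfl
  | succ n ih => rw [← add_assoc, answerTrace, ih, h]

theorem noise_eq_false (P : Protocol X Y) (a : ℕ → Bool) (x : ∀ i, X i) {m : ℕ}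
    (h : P.next (P.answerTrace a m) = none) (n : ℕ) : P.noise a x (m + n) = false := by
  rw [noise, P.answerTrace_of_next_eq_none a h, h]

-- An answer is a lie for `x` exactly when the bit sent on the input `x` has to be inverted to agree
-- with it. After the end of the communication neither side counts anything.
open Finset in
theorem card_noise_le_lies_toTree (P : Protocol X Y) (y : Y) (a : ℕ → Bool) (x : ∀ i, X i)
    (n : ℕ) : ∀ m, ((range n).filter fun t => P.noise a x (m + t) = true).card ≤
      (P.toTree y n (P.answerTrace a m)).lies x fun t => a (m + t) := by
  classical
  induction n with
  | zero => intro m; simp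
  | succ n ih =>
    intro m
    have ih := ih (m + 1)
    rw [answerTrace] at ih
    rw [toTree]
    rcases h : P.next (P.answerTrace a m) with _ | ⟨i, j⟩
    · simp [P.noise_eq_false a x h]
    · rw [h] at ih
      simp only [StrategyTree.lies, card_filter, add_zero] at ih ⊢
      rw [sum_range_succ', add_comm]
      have e1 : ∀ t, m + (t + 1) = m + 1 + t := fun t => by omega
      have e1' : (fun t => a (m + (t + 1))) = fun t => a (m + 1 + t) := funext fun t => by rw [e1]
      simp only [e1']
      refine add_le_add ?_ ((sum_congr rfl fun t _ => by rw [e1 t]).trans_le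
        (ih.trans (le_of_eq ?_)))
      · simp only [add_zero, noise, h, Set.mem_ofPred_eq]
        cases a m <;>
          rcases Bool.eq_false_or_eq_true (P.msg i (x i) (P.view i (P.answerTrace a m)) j) with
            h' | h' <;> simp [h']
      · cases a m <;> simp

open Finset in
theorem errors_noise_le_lies_toTree (P : Protocol X Y) (y : Y) (a : ℕ → Bool) (x : ∀ i, X i)
    (n : ℕ) : P.errors x (P.noise a x) n ≤ (P.toTree y n []).lies x a := by
  have h := P.card_noise_le_lies_toTree y a x n 0
  simp only [zero_add, answerTrace] at h
  refine le_trans (card_le_card ?_) h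
  apply filter_subset_filter
  rw [trace_noise]
  exact range_subset_range.2 (P.length_answerTrace_le a n)

theorem paulWins_of_proofAgainst [∀ i, Nonempty (X i)] (hk : 2 ≤ k) {f : (∀ i, X i) → Y}
    {q l : ℕ} (P : Protocol X Y) (hq : P.ExchangesAtMost q) (hl : P.ProofAgainst f l) :
    PaulWins f q l := by
  have y : Y := f fun i => Classical.arbitrary (X i)
  have out : ∀ a x, (P.toTree y q []).lies x a ≤ l →
      ∀ i, P.out i (x i) (P.view i (P.answerTrace a q)) = f x := by
    intro a x hx i
    have := hl x (P.noise a x) q (hq x _) ((P.errors_noise_le_lies_toTree y a x q).trans hx) i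
    rwa [trace_noise] at this
  -- The mixed tuple has coordinate 0 from `x'` and coordinate 1 from `x`. All three tuples have the
  -- same trace, so processor 0 outputs `f x'` and processor 1 outputs `f x`, and both outputs are
  -- correct for the mixed tuple.
  have key : ∀ a x x', (P.toTree y q []).lies x a ≤ l → (P.toTree y q []).lies x' a ≤ l →
      (P.toTree y q []).lies (Function.update x ⟨0, by omega⟩ (x' ⟨0, by omega⟩)) a ≤ l →
      f x = f x' := by
    intro a x x' hx hx' hu
    have h0 := out a _ hu ⟨0, by omega⟩
    have h1 := out a _ hu ⟨1, by omega⟩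
    rw [Function.update_self, out a x' hx'] at h0
    rw [Function.update_of_ne (by simp), out a x hx] at h1
    rw [h1, h0]
  obtain ⟨T, h1, h2⟩ := StrategyTree.exists_wins_of_determined f l (P.toTree y q []) (by
    intro a x x' hx hx'
    have h := StrategyTree.lies_update_add_lies_update (P.toTree y q []) ⟨0, by omega⟩ x x' a
    by_cases hu : (P.toTree y q []).lies (Function.update x ⟨0, by omega⟩ (x' ⟨0, by omega⟩)) a ≤ l
    · exact key a x x' hx hx' hu
    -- The lies of the two mixed tuples add up to at most `2 * l`, so the other one is possible.
    · exact (key a x' x hx' hx (by omega)).symm)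
  exact ⟨T, h1.trans_le (P.depth_toTree_le y q []), h2⟩

end Protocol

/-! ### Existence of tree codes -/

open Finset

/-- The linear labelling in which the arc to `p` carries the sum over `𝔽₂` of the letters `g m`
over those `m` for which the last but `m` bit of `p` is `true`. -/
def linearCode (g : ℕ → Letter) : List Bool → Letter
  | [] => fun _ => false
  | a :: p => fun b => xor (a && g p.length b) (linearCode g p b)

theorem linearCode_congr {g g' : ℕ → Letter} {d : List Bool} (h : ∀ m < d.length, g m = g' m) :
    linearCode g d = linearCode g' d := by
  induction d with
  | nil => rfl
  | cons a p ih =>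
    rw [linearCode, linearCode, ih fun m hm => h m (hm.trans (by simp)), h p.length (by simp)]

theorem linearCode_zipWith_xor (g : ℕ → Letter) (b : Fin 4) (u : List Bool) :
    ∀ v : List Bool, u.length = v.length → linearCode g (List.zipWith xor u v) b =
      xor (linearCode g u b) (linearCode g v b) := by
  induction u with
  | nil =>
    intro v hv
    obtain rfl : v = [] := List.length_eq_zero_iff.1 hv.symm
    rfl
  | cons a u ih =>
    rintro (_ | ⟨a', v⟩) hv
    · simp at hv
    · have hv' : u.length = v.length := by simpa using hv
      simp only [List.zipWith_cons_cons, linearCode, ih v hv', List.length_zipWith, hv', min_self]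
      cases a <;> cases a' <;> cases g v.length b <;> cases linearCode g u b <;>
        cases linearCode g v b <;> rfl

/-- Coefficients are indexed by the distance from the end, so a common prefix contributes equally to
both letters and cancels. This reduces the tree code property to single words that begin with
`true`. -/
theorem linearCode_append_eq_iff (g : ℕ → Letter) (p u v : List Bool) (h : u.length = v.length) :
    linearCode g (p ++ u) = linearCode g (p ++ v) ↔
      linearCode g (List.zipWith xor u v) = fun _ => false := by
  induction p with
  | nil =>
    simp only [List.nil_append, funext_iff, linearCode_zipWith_xor g _ u v h]
    refine forall_congr' fun b => ?_
    cases linearCode g u b <;> cases linearCode g v b <;> simp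
  | cons a p ih =>
    rw [← ih, List.cons_append, List.cons_append]
    simp only [linearCode, List.length_append, h, funext_iff, Bool.xor_right_inj]

/-- The weight of a bit string: a factor `5` for every vanishing letter on the branch and `1 / 5`
for every other letter. -/
noncomputable def branchWeight (g : ℕ → Letter) (d : List Bool) : ℝ :=
  ∏ t ∈ range d.length, if linearCode g (d.take (t + 1)) = fun _ => false then 5 else 1 / 5

theorem branchWeight_nonneg (g : ℕ → Letter) (d : List Bool) : 0 ≤ branchWeight g d :=
  prod_nonneg fun t _ => by split_ifs <;> norm_num

theorem branchWeight_concat (g : ℕ → Letter) (d : List Bool) (b : Bool) :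
    branchWeight g (d ++ [b]) =
      branchWeight g d * if linearCode g (d ++ [b]) = fun _ => false then 5 else 1 / 5 := by
  rw [branchWeight, List.length_append, List.length_singleton, prod_range_succ, branchWeight]
  congr 1
  · refine prod_congr rfl fun t ht => ?_
    rw [List.take_append_of_le_length (by simpa [Nat.succ_le_iff] using ht)]
  · rw [List.take_of_length_le (by simp)]

theorem branchWeight_congr {g g' : ℕ → Letter} {d : List Bool} (h : ∀ m < d.length, g m = g' m) :
    branchWeight g d = branchWeight g' d := by
  refine prod_congr rfl fun t _ => ?_
  rw [linearCode_congr fun m hm => h m (hm.trans_le (by simp))]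

/-- The weight is the power of `5` whose exponent is the number of vanishing letters minus the
number of the others. -/
theorem length_le_of_branchWeight_lt_one {g : ℕ → Letter} {d : List Bool}
    (h : branchWeight g d < 1) : d.length ≤
      2 * ((range d.length).filter fun t =>
        linearCode g (d.take (t + 1)) ≠ fun _ => false).card := by
  rw [branchWeight, prod_ite, prod_const, prod_const] at h
  have hc := card_filter_add_card_filter_not (s := range d.length)
    fun t => linearCode g (d.take (t + 1)) = fun _ => false
  rw [card_range] at hc
  by_contra! hlt
  refine absurd h (not_lt.2 ?_)
  rw [one_div, inv_pow, ← div_eq_mul_inv, one_le_div (by positivity)]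
  exact pow_le_pow_right₀ (by norm_num) (by simp only [ne_eq] at hlt; omega)

/-- The bit strings of length `n + 1` that begin with `true`. -/
def stringsFromTrue : ℕ → List (List Bool)
  | 0 => [[true]]
  | n + 1 => (stringsFromTrue n).flatMap fun d => [d ++ [false], d ++ [true]]

theorem mem_stringsFromTrue {n : ℕ} : ∀ {d : List Bool},
    d ∈ stringsFromTrue n ↔ ∃ s : List Bool, d = true :: s ∧ s.length = n := by
  induction n with
  | zero => intro d; simp [stringsFromTrue]
  | succ n ih =>
    intro d
    simp only [stringsFromTrue, List.mem_flatMap, List.mem_cons, List.not_mem_nil, or_false]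
    constructor
    · rintro ⟨d', hd', h⟩
      obtain ⟨s, rfl, hs⟩ := ih.1 hd'
      rcases h with rfl | rfl
      · exact ⟨s ++ [false], rfl, by simp [hs]⟩
      · exact ⟨s ++ [true], rfl, by simp [hs]⟩
    · rintro ⟨s, rfl, hs⟩
      obtain ⟨s', b, rfl⟩ : ∃ s' b, s = s' ++ [b] := by
        rcases List.eq_nil_or_concat s with rfl | ⟨s', b, rfl⟩
        · simp at hs
        · exact ⟨s', b, by simp⟩
      refine ⟨true :: s', ih.2 ⟨s', rfl, by simpa using hs⟩, ?_⟩
      cases b <;> simp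

/-- The total weight of the bit strings of length `n + 1` that begin with `true`. -/
noncomputable def totalWeight (g : ℕ → Letter) (n : ℕ) : ℝ :=
  ((stringsFromTrue n).map (branchWeight g)).sum

theorem totalWeight_succ (g : ℕ → Letter) (n : ℕ) : totalWeight g (n + 1) =
    ((stringsFromTrue n).map fun d =>
      branchWeight g (d ++ [false]) + branchWeight g (d ++ [true])).sum := by
  rw [totalWeight, stringsFromTrue, List.map_flatMap]
  simp [List.flatMap, List.sum_flatten, Function.comp_def]

theorem totalWeight_congr {g g' : ℕ → Letter} {n : ℕ} (h : ∀ m ≤ n, g m = g' m) :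
    totalWeight g n = totalWeight g' n := by
  rw [totalWeight, totalWeight]
  congr 1
  refine List.map_congr_left fun d hd => ?_
  obtain ⟨s, rfl, hs⟩ := mem_stringsFromTrue.1 hd
  exact branchWeight_congr fun m hm => h m (by simp at hm; omega)

/-- The leading `true` adds the new coefficient to a sum of earlier ones, so exactly one of its 16
values makes the letter vanish: `5 + 15 / 5 = 8`. -/
theorem sum_factor_update (g : ℕ → Letter) (s : List Bool) :
    ∑ y : Letter, (if linearCode (Function.update g s.length y) (true :: s) = fun _ => false
      then (5 : ℝ) else 1 / 5) = 8 := by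
  have h : ∀ y : Letter, linearCode (Function.update g s.length y) (true :: s) = (fun _ => false) ↔
      y = linearCode g s := by
    intro y
    rw [linearCode, linearCode_congr (g' := g) fun m hm => Function.update_of_ne hm.ne _ _]
    simp only [Function.update_self, Bool.true_and, funext_iff, bne_eq_false_iff_eq]
  simp only [h, sum_ite, sum_const, filter_eq', mem_univ, if_true, filter_ne', card_singleton,
    card_erase_of_mem, card_univ, Fintype.card_fun, Fintype.card_fin, Fintype.card_bool]
  norm_num

/-- On average over the new coefficient an extension halves the weight (`8 / 16`), and every string
has two extensions. -/
theorem sum_totalWeight_update (g : ℕ → Letter) (n : ℕ) :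
    ∑ y : Letter, totalWeight (Function.update g (n + 1) y) (n + 1) = 16 * totalWeight g n := by
  have hcomm : ∀ (L : List (List Bool)) (F : Letter → List Bool → ℝ),
      ∑ y : Letter, (L.map (F y)).sum = (L.map fun d => ∑ y : Letter, F y d).sum := by
    intro L F
    induction L with
    | nil => simp
    | cons d L ih => simp [sum_add_distrib, ih]
  simp only [totalWeight_succ]
  rw [totalWeight, ← List.sum_map_mul_left, hcomm]
  congr 1
  refine List.map_congr_left fun d hd => ?_
  obtain ⟨s, rfl, hs⟩ := mem_stringsFromTrue.1 hd
  have hsum : ∀ b : Bool, ∑ y : Letter,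
      branchWeight (Function.update g (n + 1) y) (true :: s ++ [b]) =
        branchWeight g (true :: s) * 8 := by
    intro b
    have h := sum_factor_update g (s ++ [b])
    rw [List.length_append, hs, List.length_singleton] at h
    rw [← h, mul_sum]
    refine sum_congr rfl fun y _ => ?_
    rw [branchWeight_concat]
    congr 1
    exact branchWeight_congr fun m hm =>
      Function.update_of_ne (by simp only [List.length_cons] at hm; omega) _ _
  rw [sum_add_distrib, hsum, hsum]
  ring

/-- Some value of the next coefficient does no worse than the average, and it leaves the totals for
shorter strings unchanged. The initial `1 / 5` comes from the nonzero letter on `[true]`. -/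
theorem exists_totalWeight_le (n : ℕ) : ∃ g : ℕ → Letter, ∀ m ≤ n, totalWeight g m ≤ 1 / 5 := by
  induction n with
  | zero =>
    refine ⟨fun _ _ => true, fun m hm => ?_⟩
    obtain rfl : m = 0 := by omega
    simp [totalWeight, stringsFromTrue, branchWeight, linearCode, funext_iff]
  | succ n ih =>
    obtain ⟨g, hg⟩ := ih
    obtain ⟨y, -, hy⟩ := exists_le_of_sum_le (s := (univ : Finset Letter)) univ_nonempty
      (f := fun y => totalWeight (Function.update g (n + 1) y) (n + 1))
      (g := fun _ => totalWeight g n) (by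
        rw [sum_totalWeight_update]
        simp)
    refine ⟨Function.update g (n + 1) y, fun m hm => ?_⟩
    rcases Nat.lt_or_eq_of_le hm with hm | rfl
    · rw [totalWeight_congr (g' := g) fun m' hm' => Function.update_of_ne (by omega) _ _]
      exact hg m (by omega)
    · exact hy.trans (hg n le_rfl)

theorem exists_isTreeCode (n : ℕ) : ∃ C : List Bool → Letter, IsTreeCode C (1 / 2) n := by
  obtain ⟨g, hg⟩ := exists_totalWeight_le n
  refine ⟨linearCode g, fun p u v huv hne hn => ?_⟩
  rcases u with _ | ⟨a, u⟩
  · simp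
  rcases v with _ | ⟨a', v⟩
  · simp at huv
  -- The words branch at their first bit, so their difference is one of the strings that
  -- `totalWeight` controls.
  have hs : List.zipWith xor (a :: u) (a' :: v) = true :: List.zipWith xor u v := by
    have : a ≠ a' := by simpa using hne
    cases a <;> cases a' <;> simp_all
  have hl : (List.zipWith xor u v).length = u.length := by
    simp only [List.length_cons] at huv
    simp only [List.length_zipWith]; omega
  have hw : branchWeight g (true :: List.zipWith xor u v) < 1 := by
    have h1 := hg u.length (by simp at hn; omega)
    have h2 : branchWeight g (true :: List.zipWith xor u v) ≤ totalWeight g u.length := by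
      refine List.single_le_sum ?_ _ (List.mem_map_of_mem (mem_stringsFromTrue.2 ⟨_, rfl, hl⟩))
      simp only [List.mem_map]
      rintro _ ⟨d, -, rfl⟩
      exact branchWeight_nonneg g d
    linarith
  have key := length_le_of_branchWeight_lt_one hw
  rw [← hs] at key
  have hl' : (List.zipWith xor (a :: u) (a' :: v)).length = (a :: u).length := by
    simp only [List.length_zipWith, huv, min_self]
  rw [hl'] at key
  have h3 : ∀ t, linearCode g (p ++ (a :: u).take (t + 1)) ≠
      linearCode g (p ++ (a' :: v).take (t + 1)) ↔
      linearCode g ((List.zipWith xor (a :: u) (a' :: v)).take (t + 1)) ≠ fun _ => false := by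
    intro t
    rw [Ne, linearCode_append_eq_iff _ _ _ _ (by simp at huv; simp [huv]), List.take_zipWith]
  simp only [h3]
  have : ((a :: u).length : ℝ) ≤ ((2 * ((range (a :: u).length).filter fun t =>
    linearCode g ((List.zipWith xor (a :: u) (a' :: v)).take (t + 1)) ≠
      fun _ => false).card : ℕ) : ℝ) := by exact_mod_cast key
  push_cast at this ⊢
  linarith

/-! ### Branches of a semi-static strategy -/

namespace StrategyTree

variable {k : ℕ} {X : Fin k → Type u} {Y : Type v}

/-- Expresses lies through the answers computed by the processors, so that they can be charged to
transmission errors. -/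
theorem lies_le_card (x : ∀ i, X i) (T : StrategyTree X Y) : ∀ (idx : List (Fin k)) (w : List Bool),
    T.IsSemiStatic idx → w.length = idx.length →
    T.lies x (fun m => w.getD m false) ≤ ((range idx.length).filter fun d =>
      ∃ i, idx[d]? = some i ∧ w.getD d false ≠ T.answer i (x i) (w.take d)).card := by
  classical
  induction T with
  | leaf y => intros; simp [lies]
  | node i F no yes ihn ihy =>
    rintro (_ | ⟨j, idx⟩) w hs hw
    · simp [IsSemiStatic] at hs
    obtain ⟨rfl, hn, hy⟩ := hs
    rcases w with _ | ⟨b, w⟩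
    · simp at hw
    have hw' : w.length = idx.length := by simpa using hw
    have h1 := ihn idx w hn hw'
    have h2 := ihy idx w hy hw'
    rw [List.length_cons, card_filter, sum_range_succ']
    rw [card_filter] at h1 h2
    simp only [lies, List.getD_cons_zero, List.getD_cons_succ, List.getElem?_cons_zero,
      List.getElem?_cons_succ, List.take_succ_cons, List.take_zero, Option.some.injEq,
      exists_eq_left', answer, dif_pos]
    rw [add_comm]
    cases b
    · refine Nat.add_le_add (by simpa [answer] using h1) ?_
      by_cases hx : x i ∈ F <;> simp [hx]
    · refine Nat.add_le_add (by simpa [answer] using h2) ?_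
      by_cases hx : x i ∈ F <;> simp [hx]

variable (c : Fin k) (x : X c)

/-- The central processor never retracts a move, so letters sent early belong to its final branch.
-/
theorem track_prefix (T : StrategyTree X Y) (more : List Bool) : ∀ bits : List Bool,
    T.track c x bits <+: T.track c x (bits ++ more) := by
  induction T with
  | leaf y => intro bits; simp [track]
  | node i F no yes ihn ihy =>
    intro bits
    by_cases h : c = i
    · subst h
      by_cases hx : x ∈ F
      · simpa [track, hx] using ihy bits
      · simpa [track, hx] using ihn bits
    · rcases bits with _ | ⟨_ | _, bits⟩
      · simp [track, h]
      · simpa [track, h] using ihn bits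
      · simpa [track, h] using ihy bits

theorem length_track_le (T : StrategyTree X Y) : ∀ (idx : List (Fin k)) (bits : List Bool),
    T.IsSemiStatic idx → (T.track c x bits).length ≤ idx.length := by
  induction T with
  | leaf y => intros; simp [track]
  | node i F no yes ihn ihy =>
    rintro (_ | ⟨j, idx⟩) bits hs
    · simp [IsSemiStatic] at hs
    obtain ⟨rfl, hn, hy⟩ := hs
    by_cases h : c = i
    · subst h
      by_cases hx : x ∈ F
      · simpa [track, hx] using ihy idx bits hy
      · simpa [track, hx] using ihn idx bits hn
    · rcases bits with _ | ⟨_ | _, bits⟩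
      · simp [track, h]
      · simpa [track, h] using ihn idx bits hn
      · simpa [track, h] using ihy idx bits hy

/-- Before a leaf, the branch stops only for want of an answer from another processor. -/
theorem le_length_track (T : StrategyTree X Y) : ∀ (idx : List (Fin k)) (bits : List Bool) (d : ℕ),
    T.IsSemiStatic idx → d ≤ idx.length → (idx.take d).countP (· ≠ c) ≤ bits.length →
    d ≤ (T.track c x bits).length := by
  induction T with
  | leaf y =>
    rintro (_ | ⟨j, idx⟩) bits d hs hd -
    · simpa [track] using hd
    · simp [IsSemiStatic] at hs
  | node i F no yes ihn ihy =>
    rintro (_ | ⟨j, idx⟩) bits (_ | d) hs hd hb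
    · simp
    · simp at hd
    · simp
    obtain ⟨rfl, hn, hy⟩ := hs
    have hd' : d ≤ idx.length := by simpa using hd
    by_cases h : c = i
    · subst h
      have hb' : (idx.take d).countP (· ≠ c) ≤ bits.length := by simpa using hb
      by_cases hx : x ∈ F
      · simpa [track, hx] using ihy idx bits d hy hd' hb'
      · simpa [track, hx] using ihn idx bits d hn hd' hb'
    · rw [List.take_succ_cons, List.countP_cons_of_pos (by simpa using Ne.symm h)] at hb
      rcases bits with _ | ⟨_ | _, bits⟩
      · simp at hb
      · simpa [track, h] using ihn idx bits d hn hd' (by simpa using hb)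
      · simpa [track, h] using ihy idx bits d hy hd' (by simpa using hb)

theorem getD_track_of_ne (T : StrategyTree X Y) :
    ∀ (idx : List (Fin k)) (bits : List Bool) (d : ℕ) (i : Fin k),
    T.IsSemiStatic idx → idx[d]? = some i → i ≠ c → d < (T.track c x bits).length →
    (T.track c x bits).getD d false = bits.getD ((idx.take d).countP (· ≠ c)) false := by
  induction T with
  | leaf y => intro _ _ _ _ _ _ _ h; simp [track] at h
  | node i F no yes ihn ihy =>
    rintro (_ | ⟨j, idx⟩) bits d i' hs hi hne hd
    · simp [IsSemiStatic] at hs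
    obtain ⟨rfl, hn, hy⟩ := hs
    rcases d with _ | d
    · obtain rfl : i = i' := by simpa using hi
      rcases bits with _ | ⟨_ | _, bits⟩ <;> simp [track, Ne.symm hne]
    have hi' : idx[d]? = some i' := by simpa using hi
    by_cases h : c = i
    · subst h
      by_cases hx : x ∈ F
      · simpa [track, hx] using ihy idx bits d i' hy hi' hne (by simpa [track, hx] using hd)
      · simpa [track, hx] using ihn idx bits d i' hn hi' hne (by simpa [track, hx] using hd)
    · rw [List.take_succ_cons, List.countP_cons_of_pos (by simpa using Ne.symm h)]
      rcases bits with _ | ⟨_ | _, bits⟩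
      · simp [track, h] at hd
      · simpa [track, h] using ihn idx bits d i' hn hi' hne (by simpa [track, h] using hd)
      · simpa [track, h] using ihy idx bits d i' hy hi' hne (by simpa [track, h] using hd)

theorem getD_track_self (T : StrategyTree X Y) :
    ∀ (idx : List (Fin k)) (bits : List Bool) (d : ℕ),
    T.IsSemiStatic idx → idx[d]? = some c → d < (T.track c x bits).length →
    (T.track c x bits).getD d false = T.answer c x ((T.track c x bits).take d) := by
  induction T with
  | leaf y => intro _ _ _ _ _ h; simp [track] at h
  | node i F no yes ihn ihy =>
    rintro (_ | ⟨j, idx⟩) bits d hs hi hd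
    · simp [IsSemiStatic] at hs
    obtain ⟨rfl, hn, hy⟩ := hs
    rcases d with _ | d
    · obtain rfl : i = c := by simpa using hi
      by_cases hx : x ∈ F <;> simp [track, answer, hx]
    have hi' : idx[d]? = some c := by simpa using hi
    by_cases h : c = i
    · subst h
      by_cases hx : x ∈ F
      · simpa [track, answer, hx] using ihy idx bits d hy hi' (by simpa [track, hx] using hd)
      · simpa [track, answer, hx] using ihn idx bits d hn hi' (by simpa [track, hx] using hd)
    · rcases bits with _ | ⟨_ | _, bits⟩
      · simp [track, h] at hd
      · simpa [track, answer, h] using ihn idx bits d hn hi' (by simpa [track, h] using hd)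
      · simpa [track, answer, h] using ihy idx bits d hy hi' (by simpa [track, h] using hd)

end StrategyTree

/-! ### Minimum distance decoding -/

theorem length_decode (C : List Bool → Letter) (bits : List Bool) :
    (decode C bits).length = bits.length / 4 :=
  Function.argminOn_mem (codeDist C bits (bits.length / 4)) {w | w.length = bits.length / 4} _

theorem codeDist_decode_le (C : List Bool → Letter) (bits w : List Bool)
    (hw : w.length = bits.length / 4) :
    codeDist C bits (bits.length / 4) (decode C bits) ≤ codeDist C bits (bits.length / 4) w :=
  Function.argminOn_le (codeDist C bits (bits.length / 4)) {w | w.length = bits.length / 4} hw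

theorem exists_common_prefix {α : Type*} : ∀ u v : List α, u.length = v.length → u ≠ v →
    ∃ p u' v', u = p ++ u' ∧ v = p ++ v' ∧ u'.length = v'.length ∧ u'.head? ≠ v'.head? := by
  classical
  intro u
  induction u with
  | nil =>
    intro v hv hne
    exact (hne (List.length_eq_zero_iff.1 hv.symm).symm).elim
  | cons a u ih =>
    rintro (_ | ⟨b, v⟩) hv hne
    · simp at hv
    by_cases hab : a = b
    · subst hab
      obtain ⟨p, u', v', rfl, rfl, h1, h2⟩ := ih v (by simpa using hv) (by simpa using hne)
      exact ⟨a :: p, u', v', rfl, rfl, h1, h2⟩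
    · exact ⟨[], a :: u, b :: v, rfl, rfl, hv, by simpa using hab⟩

theorem letterAt_take {bits : List Bool} {D t : ℕ} (h : t < D) :
    letterAt (bits.take (4 * D)) t = letterAt bits t := by
  funext b
  have hb : 4 * t + (b : ℕ) < 4 * D := by omega
  simp [letterAt, List.getD_eq_getElem?_getD, hb]

/-- If decoding fails, then many of the last letters, as many as a quarter of the distance to the
common ancestor, are wrong. -/
theorem exists_errors_of_decode_ne {C : List Bool → Letter} {n D : ℕ} (hC : IsTreeCode C (1 / 2) n)
    {bits w : List Bool} (hw : w.length = n) (hb : 4 * D ≤ bits.length) (hD : D ≤ n)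
    (hne : decode C (bits.take (4 * D)) ≠ w.take D) :
    ∃ m, 1 ≤ m ∧ m ≤ D ∧
      (decode C (bits.take (4 * D))).take (D - m) = w.take (D - m) ∧
      m ≤ 4 * ((Ico (D - m) D).filter fun t => C (w.take (t + 1)) ≠ letterAt bits t).card := by
  have hlen : (bits.take (4 * D)).length / 4 = D := by
    rw [List.length_take, min_eq_left hb]; omega
  have hle := codeDist_decode_le C (bits.take (4 * D)) (w.take D) (by
    rw [hlen, List.length_take, hw, min_eq_left hD])
  have hvl := length_decode C (bits.take (4 * D))
  rw [hlen] at hle hvl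
  generalize decode C (bits.take (4 * D)) = v at *
  have hwl : (w.take D).length = D := by simp [hw, hD]
  obtain ⟨p, v', w', hv, hw', hl, hh⟩ := exists_common_prefix v (w.take D) (by omega) hne
  have hvl' : p.length + v'.length = D := by rw [← hvl, hv, List.length_append]
  have hcode := hC p v' w' hl hh (by omega)
  have hm : 1 ≤ v'.length := by
    rcases v' with _ | ⟨a, v'⟩
    · obtain rfl : w' = [] := List.length_eq_zero_iff.1 hl.symm
      simp at hh
    · simp
  have hp : D - v'.length = p.length := by omega
  have hwp : w.take p.length = p := by
    have : (w.take D).take p.length = p := by rw [hw', List.take_left]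
    rwa [List.take_take, min_eq_left (by omega)] at this
  refine ⟨v'.length, hm, by omega, by rw [hp, hwp, hv, List.take_left], ?_⟩
  rw [hp]
  have htk : ∀ t < D, (w.take D).take (t + 1) = w.take (t + 1) := fun t ht => by
    rw [List.take_take, min_eq_left (by omega)]
  have hsplit : ∀ P : ℕ → Prop, ∀ [DecidablePred P], ((range D).filter P).card =
      ((range p.length).filter P).card + ((Ico p.length D).filter P).card := by
    intro P _
    simp only [card_filter]
    rw [sum_range_add_sum_Ico _ (by omega)]
  -- Up to the branching both branches carry the same letters, so the minimality of the decoded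
  -- branch survives restriction to the positions after it.
  have hle' : ((Ico p.length D).filter fun t => C (v.take (t + 1)) ≠ letterAt bits t).card ≤
      ((Ico p.length D).filter fun t => C (w.take (t + 1)) ≠ letterAt bits t).card := by
    rw [codeDist, codeDist, hsplit, hsplit] at hle
    have e1 : ((range p.length).filter fun t =>
        C (v.take (t + 1)) ≠ letterAt (bits.take (4 * D)) t) =
        (range p.length).filter fun t =>
          C ((w.take D).take (t + 1)) ≠ letterAt (bits.take (4 * D)) t := by
      refine filter_congr fun t ht => ?_
      rw [mem_range] at ht
      rw [hw', hv, List.take_append_of_le_length (by omega),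
        List.take_append_of_le_length (by omega)]
    rw [e1] at hle
    have hle := Nat.le_of_add_le_add_left hle
    have e2 : ∀ z : List Bool, ((Ico p.length D).filter fun t =>
        C (z.take (t + 1)) ≠ letterAt (bits.take (4 * D)) t) =
        (Ico p.length D).filter fun t => C (z.take (t + 1)) ≠ letterAt bits t := by
      intro z
      refine filter_congr fun t ht => ?_
      rw [letterAt_take (mem_Ico.1 ht).2]
    rw [e2, e2] at hle
    refine hle.trans (le_of_eq ?_)
    congr 1
    refine filter_congr fun t ht => ?_
    rw [htk t (mem_Ico.1 ht).2]
  have hshift : ((range v'.length).filter fun t =>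
        C (p ++ v'.take (t + 1)) ≠ C (p ++ w'.take (t + 1))).card ≤
      ((Ico p.length D).filter fun t => C (v.take (t + 1)) ≠ C (w.take (t + 1))).card := by
    rw [card_filter, card_filter, sum_Ico_eq_sum_range, show D - p.length = v'.length by omega]
    refine le_of_eq (sum_congr rfl fun t ht => ?_)
    rw [mem_range] at ht
    rw [← htk (p.length + t) (by omega), hw', hv, add_assoc, List.take_length_add_append,
      List.take_length_add_append]
  have htri : ((Ico p.length D).filter fun t => C (v.take (t + 1)) ≠ C (w.take (t + 1))).card ≤
      ((Ico p.length D).filter fun t => C (v.take (t + 1)) ≠ letterAt bits t).card +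
      ((Ico p.length D).filter fun t => C (w.take (t + 1)) ≠ letterAt bits t).card := by
    refine le_trans (card_le_card fun t ht => ?_) (card_union_le _ _)
    simp only [mem_union, mem_filter] at ht ⊢
    by_contra hcon
    push Not at hcon
    exact ht.2 ((hcon.1 ht.1).trans (hcon.2 ht.1).symm)
  -- The two branches differ in at least half of these positions. By the triangle inequality the
  -- received word accounts for this, and the larger share, at least a quarter, falls to `w`.
  have hfin : (v'.length : ℝ) ≤ ((4 * ((Ico p.length D).filter fun t =>
      C (w.take (t + 1)) ≠ letterAt bits t).card : ℕ) : ℝ) := by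
    have h1 : (((range v'.length).filter fun t =>
        C (p ++ v'.take (t + 1)) ≠ C (p ++ w'.take (t + 1))).card : ℝ) ≤
        ((2 * ((Ico p.length D).filter fun t =>
          C (w.take (t + 1)) ≠ letterAt bits t).card : ℕ) : ℝ) := by
      exact Nat.cast_le.2 (by omega)
    push_cast at h1 ⊢
    linarith
  exact_mod_cast hfin

open Classical in
/-- If every bad time ends an interval in which at least a quarter of the times are erroneous, then
the bad times are at most four times as many as the errors. -/
theorem card_bad_le_four_mul {n : ℕ} {bad err : ℕ → Prop}
    (h : ∀ D ≤ n, bad D → ∃ m, 1 ≤ m ∧ m ≤ D ∧ m ≤ 4 * ((Ico (D - m) D).filter err).card) :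
    ∀ D ≤ n, ((range (D + 1)).filter bad).card ≤ 4 * ((range D).filter err).card := by
  intro D
  induction D using Nat.strong_induction_on with
  | _ D ih =>
    intro hD
    by_cases hb : bad D
    -- The last `m` times contain at most `m` bad ones, paid for by the errors of their own
    -- interval. The induction resumes at `D - m`, so no error is charged twice.
    · obtain ⟨m, hm, hmD, hme⟩ := h D hD hb
      have h1 := ih (D - m) (by omega) (by omega)
      have h2 : ((range (D + 1)).filter bad).card =
          ((range (D - m + 1)).filter bad).card +
            ((Ico (D - m + 1) (D + 1)).filter bad).card := by
        simp only [card_filter]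
        rw [sum_range_add_sum_Ico _ (by omega)]
      have h3 : ((range D).filter err).card =
          ((range (D - m)).filter err).card + ((Ico (D - m) D).filter err).card := by
        simp only [card_filter]
        rw [sum_range_add_sum_Ico _ (by omega)]
      have h4 := card_filter_le (Ico (D - m + 1) (D + 1)) bad
      rw [Nat.card_Ico] at h4
      omega
    · rw [range_add_one, filter_insert, if_neg hb]
      rcases D with _ | D
      · simp
      · refine (ih D (by omega) (by omega)).trans (Nat.mul_le_mul_left _ (card_le_card ?_))
        exact filter_subset_filter _ (range_subset_range.2 (by omega))

/-- The branch `w` that the central processor follows, and all decoded branches, contain few lies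
if few bits are transmitted incorrectly. Here `r j` is the sequence of the bits received by `j`. -/
theorem values_eq_of_errors_le {k : ℕ} {X : Fin k → Type u} {Y : Type v} {f : (∀ i, X i) → Y}
    {l : ℕ} {c : Fin k} {T : StrategyTree X Y} {idx : List (Fin k)} {C : List Bool → Letter}
    (hs : T.IsSemiStatic idx) (hT : T.Wins f l) (hC : IsTreeCode C (1 / 2) idx.length)
    (x : ∀ i, X i) {w : List Bool} (hw : w.length = idx.length) {r : Fin k → List Bool}
    (hr : ∀ j ≠ c, (r j).length = 4 * idx.length)
    (hself : ∀ d < idx.length, idx[d]? = some c →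
      w.getD d false = T.answer c (x c) (w.take d))
    {E : Fin k → ℕ}
    (hE : ∀ j ≠ c, ((range idx.length).filter fun t =>
      C (w.take (t + 1)) ≠ letterAt (r j) t).card ≤ E j)
    (hEc : ((range idx.length).filter fun d => ∃ i, i ≠ c ∧ idx[d]? = some i ∧
      w.getD d false ≠ T.answer i (x i) (decode C ((r i).take (4 * d)))).card ≤ E c)
    (hl : 4 * ∑ j, E j ≤ l) :
    T.value (fun m => w.getD m false) = f x ∧
      ∀ j ≠ c, T.value (fun m => (decode C (r j)).getD m false) = f x := by
  classical
  have hbad : ∀ j ≠ c, ∀ D ≤ idx.length,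
      ((range (D + 1)).filter fun d => decode C ((r j).take (4 * d)) ≠ w.take d).card ≤
        4 * ((range D).filter fun t => C (w.take (t + 1)) ≠ letterAt (r j) t).card := by
    intro j hj D hD
    have h := card_bad_le_four_mul (n := idx.length)
      (bad := fun d => decode C ((r j).take (4 * d)) ≠ w.take d)
      (err := fun t => C (w.take (t + 1)) ≠ letterAt (r j) t) (by
        intro D hD hb
        obtain ⟨m, h1, h2, -, h3⟩ := exists_errors_of_decode_ne hC hw (by rw [hr j hj]; omega) hD hb
        refine ⟨m, h1, h2, h3.trans (le_of_eq ?_)⟩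
        congr!) D hD
    convert h
  -- For a branch that agrees with `w` down to depth `D`, all later answers are counted as lies.
  -- Only letters before `D` are charged, so later errors stay available.
  have hlies : ∀ v : List Bool, v.length = idx.length → ∀ D ≤ idx.length,
      v.take D = w.take D → T.lies x (fun m => v.getD m false) ≤
        4 * ∑ j ∈ univ.erase c, ((range D).filter fun t =>
          C (w.take (t + 1)) ≠ letterAt (r j) t).card + E c + (idx.length - D) := by
    intro v hv D hD hvw
    refine (T.lies_le_card x idx v hs hv).trans ?_
    have hsub : ((range idx.length).filter fun d =>
        ∃ i, idx[d]? = some i ∧ v.getD d false ≠ T.answer i (x i) (v.take d)) ⊆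
        (((univ.erase c).biUnion fun j => (range (D + 1)).filter fun d =>
          decode C ((r j).take (4 * d)) ≠ w.take d) ∪
        ((range idx.length).filter fun d => ∃ i, i ≠ c ∧ idx[d]? = some i ∧
          w.getD d false ≠ T.answer i (x i) (decode C ((r i).take (4 * d))))) ∪
        Ico D idx.length := by
      intro d hd
      simp only [mem_filter, mem_range, mem_union, mem_biUnion, mem_erase, mem_univ, and_true,
        mem_Ico] at hd ⊢
      obtain ⟨hdn, i, hi, hne⟩ := hd
      -- A lie above depth `D` does not concern `c`, which answers itself truthfully. If `i` had
      -- decoded correctly, its bit was inverted; otherwise `d` is a bad time of `i`.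
      by_cases hdD : d < D
      · left
        have h1 : v.getD d false = w.getD d false := by
          have := congrArg (fun z : List Bool => z.getD d false) hvw
          simpa [List.getD_eq_getElem?_getD, List.getElem?_take, hdD] using this
        have h2 : v.take d = w.take d := by
          have := congrArg (List.take d) hvw
          rwa [List.take_take, List.take_take, min_eq_left hdD.le] at this
        rw [h1, h2] at hne
        have hic : i ≠ c := by
          rintro rfl
          exact hne (hself d hdn hi)
        by_cases hb : decode C ((r i).take (4 * d)) = w.take d
        · right
          exact ⟨hdn, i, hic, hi, by rwa [hb]⟩
        · left
          exact ⟨i, hic, by omega, hb⟩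
      · right
        omega
    refine (card_le_card hsub).trans ((card_union_le _ _).trans ?_)
    rw [Nat.card_Ico]
    refine Nat.add_le_add_right ((card_union_le _ _).trans (Nat.add_le_add ?_ hEc)) _
    refine card_biUnion_le.trans ?_
    rw [mul_sum]
    exact sum_le_sum fun j hj => hbad j (ne_of_mem_erase hj) D hD
  -- A wrong letter may cost four lies, an inverted answer only one.
  have hsumE : 4 * ∑ j ∈ univ.erase c, E j + E c ≤ l := by
    rw [← add_sum_erase univ E (mem_univ c)] at hl
    omega
  have hwin := StrategyTree.wins_iff.1 hT
  have hwl : T.value (fun m => w.getD m false) = f x := by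
    refine hwin _ x ((hlies w hw idx.length le_rfl rfl).trans ?_)
    have := sum_le_sum fun j (hj : j ∈ univ.erase c) => hE j (ne_of_mem_erase hj)
    omega
  refine ⟨hwl, fun j hj => ?_⟩
  have htake : (r j).take (4 * idx.length) = r j := List.take_of_length_le (hr j hj).le
  by_cases hv : decode C (r j) = w
  · rw [hv, hwl]
  -- The last `m` answers on the decoded branch may all be lies. They are paid for by the errors in
  -- the last `m` letters received by `j`; the common part uses only the earlier ones.
  obtain ⟨m, h1, h2, h3, h4⟩ := exists_errors_of_decode_ne hC hw (hr j hj).ge le_rfl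
    (by rwa [htake, List.take_of_length_le hw.le])
  rw [htake] at h3
  have hvl : (decode C (r j)).length = idx.length := by
    rw [length_decode, hr j hj]; omega
  refine hwin _ x ((hlies _ hvl (idx.length - m) (by omega) h3).trans ?_)
  have hj' : j ∈ univ.erase c := mem_erase.2 ⟨hj, mem_univ j⟩
  have h5 : ((range (idx.length - m)).filter fun t => C (w.take (t + 1)) ≠ letterAt (r j) t).card +
      ((Ico (idx.length - m) idx.length).filter fun t =>
        C (w.take (t + 1)) ≠ letterAt (r j) t).card ≤ E j := by
    refine le_trans (le_of_eq ?_) (hE j hj)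
    simp only [card_filter]
    rw [sum_range_add_sum_Ico _ (by omega)]
  have h6 : ∑ j' ∈ (univ.erase c).erase j, ((range (idx.length - m)).filter fun t =>
      C (w.take (t + 1)) ≠ letterAt (r j') t).card ≤ ∑ j' ∈ (univ.erase c).erase j, E j' := by
    refine sum_le_sum fun j' hj' => le_trans (card_le_card ?_)
      (hE j' (ne_of_mem_erase (mem_of_mem_erase hj')))
    exact filter_subset_filter _ (range_subset_range.2 (by omega))
  rw [← add_sum_erase _ _ hj']
  rw [← add_sum_erase _ _ hj'] at hsumE
  omega

/-! ### The schedule -/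

section Schedule

variable {k : ℕ}

/-- The number of bits received by `j` in a list of transmissions. -/
def numReceived (j : Fin k) (S : List (Fin k × Fin k)) : ℕ := S.countP fun p => p.2 = j

theorem numReceived_append (j : Fin k) (S S' : List (Fin k × Fin k)) :
    numReceived j (S ++ S') = numReceived j S + numReceived j S' := List.countP_append

theorem numReceived_eq_zero {j : Fin k} {S : List (Fin k × Fin k)} (h : ∀ p ∈ S, p.2 ≠ j) :
    numReceived j S = 0 := List.countP_eq_zero.2 (by simpa using h)

/-- Isolates the letter sent to `j`; the answer sent to `c`, if any, comes before it. -/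
theorem roundSchedule_split {c j : Fin k} (hj : j ≠ c) (i : Fin k) : ∃ A B,
    roundSchedule c i = A ++ (List.replicate 4 (c, j) ++ B) ∧ numReceived j A = 0 ∧
      numReceived j B = 0 ∧ numReceived c A = (if i = c then 0 else 1) ∧ numReceived c B = 0 := by
  have hmem : j ∈ (List.finRange k).filter fun j => j ≠ c := by simpa using hj
  have hnd : ((List.finRange k).filter fun j => j ≠ c).Nodup := (List.nodup_finRange k).filter _
  have hc : ∀ j ∈ (List.finRange k).filter fun j => j ≠ c, j ≠ c := by simp
  unfold roundSchedule
  generalize (List.finRange k).filter (fun j => j ≠ c) = L at *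
  obtain ⟨L₁, L₂, rfl⟩ := List.append_of_mem hmem
  have hL : ∀ (L : List (Fin k)) (m : Fin k), (∀ j' ∈ L, j' ≠ m) →
      numReceived m (L.flatMap fun j => List.replicate 4 (c, j)) = 0 := by
    intro L m hm
    refine numReceived_eq_zero fun p hp => ?_
    obtain ⟨j', hj', h⟩ := List.mem_flatMap.1 hp
    rw [List.eq_of_mem_replicate h]
    exact hm j' hj'
  rw [List.nodup_append] at hnd
  have hj1 : ∀ j' ∈ L₁, j' ≠ j := fun j' h => hnd.2.2 j' h j (by simp)
  have hj2 : ∀ j' ∈ L₂, j' ≠ j := fun j' h h' => (List.nodup_cons.1 hnd.2.1).1 (h' ▸ h)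
  refine ⟨(if i = c then [] else [(i, c)]) ++ L₁.flatMap fun j => List.replicate 4 (c, j),
    L₂.flatMap fun j => List.replicate 4 (c, j), by simp, ?_, hL L₂ j hj2, ?_,
    hL L₂ c fun j' h => hc j' (by simp [h])⟩
  · rw [numReceived_append, hL L₁ j hj1]
    split_ifs <;> simp [numReceived, Ne.symm hj]
  · rw [numReceived_append, hL L₁ c fun j' h => hc j' (by simp [h])]
    split_ifs <;> simp [numReceived]

theorem numReceived_roundSchedule {c j : Fin k} (hj : j ≠ c) (i : Fin k) :
    numReceived j (roundSchedule c i) = 4 := by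
  obtain ⟨A, B, h, h1, h2, -, -⟩ := roundSchedule_split hj i
  rw [h, numReceived_append, numReceived_append, h1, h2]
  simp [numReceived]

theorem numReceived_roundSchedule_self {c j : Fin k} (hj : j ≠ c) (i : Fin k) :
    numReceived c (roundSchedule c i) = if i = c then 0 else 1 := by
  obtain ⟨A, B, h, -, -, h1, h2⟩ := roundSchedule_split hj i
  rw [h, numReceived_append, numReceived_append, h1, h2]
  simp [numReceived, hj]

theorem numReceived_flatMap {c j : Fin k} (hj : j ≠ c) (idx : List (Fin k)) :
    numReceived j (idx.flatMap (roundSchedule c)) = 4 * idx.length := by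
  induction idx with
  | nil => rfl
  | cons i idx ih =>
    rw [List.flatMap_cons, numReceived_append, ih, numReceived_roundSchedule hj, List.length_cons]
    ring

theorem numReceived_flatMap_self {c j : Fin k} (hj : j ≠ c) (idx : List (Fin k)) :
    numReceived c (idx.flatMap (roundSchedule c)) = idx.countP (· ≠ c) := by
  induction idx with
  | nil => rfl
  | cons i idx ih =>
    rw [List.flatMap_cons, numReceived_append, ih, numReceived_roundSchedule_self hj,
      List.countP_cons, add_comm]
    by_cases h : i = c <;> simp [h]

/-- At most one answer bit, and four bits to each of `k - 1` processors. -/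
theorem length_roundSchedule_le (c i : Fin k) : (roundSchedule c i).length ≤ 4 * k - 3 := by
  have h : ((List.finRange k).filter fun j => j ≠ c).length = k - 1 := by
    have h1 := List.length_eq_length_filter_add (l := List.finRange k) fun j => decide (j ≠ c)
    have h2 : ((List.finRange k).filter fun j => !decide (j ≠ c)).length = 1 := by
      have : ((List.finRange k).filter fun j => !decide (j ≠ c)) =
          (List.finRange k).filter fun j => j == c := by
        congr 1; funext j; by_cases h : j = c <;> simp [h]
      rw [this, ← List.count_eq_length_filter]
      exact List.count_eq_one_of_mem (List.nodup_finRange k) (List.mem_finRange c)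
    simp only [List.length_finRange] at h1
    omega
  have hk := c.pos
  rw [roundSchedule, List.length_append, List.length_flatMap]
  simp only [List.length_replicate, List.map_const', List.sum_replicate, h, smul_eq_mul]
  split_ifs <;> simp <;> omega

theorem length_flatMap_roundSchedule_le (c : Fin k) (idx : List (Fin k)) :
    (idx.flatMap (roundSchedule c)).length ≤ (4 * k - 3) * idx.length := by
  induction idx with
  | nil => simp
  | cons i idx ih =>
    have := length_roundSchedule_le c i
    rw [List.flatMap_cons, List.length_append, List.length_cons, mul_add, mul_one]
    omega

theorem eq_of_mem_flatMap_roundSchedule {c s r : Fin k} {idx : List (Fin k)}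
    (h : (s, r) ∈ idx.flatMap (roundSchedule c)) (hr : r ≠ c) : s = c := by
  obtain ⟨i, -, h⟩ := List.mem_flatMap.1 h
  simp only [roundSchedule, List.mem_append, List.mem_flatMap, List.mem_replicate] at h
  rcases h with h | ⟨j, -, -, h⟩
  · split_ifs at h
    · simp at h
    · simp only [List.mem_singleton, Prod.mk.injEq] at h
      exact (hr h.2).elim
  · exact (Prod.mk.inj h).1

theorem eq_take_append {α : Type*} {L : List α} {d : ℕ} {i : α} (h : L[d]? = some i) :
    L = L.take d ++ i :: L.drop (d + 1) := by
  obtain ⟨hd, rfl⟩ := List.getElem?_eq_some_iff.1 h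
  rw [← List.drop_eq_getElem_cons hd, List.take_append_drop]

/-- The transmission of the answer in the round at depth `d`. -/
theorem exists_answer_step {c i : Fin k} {idx : List (Fin k)} {d : ℕ} (h : idx[d]? = some i)
    (hi : i ≠ c) : ∃ pre post, idx.flatMap (roundSchedule c) = pre ++ (i, c) :: post ∧
      numReceived i pre = 4 * d ∧ numReceived c pre = (idx.take d).countP (· ≠ c) := by
  obtain ⟨hd, -⟩ := List.getElem?_eq_some_iff.1 h
  obtain ⟨R, hR⟩ : ∃ R, roundSchedule c i = (i, c) :: R := by
    rw [roundSchedule, if_neg hi]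
    exact ⟨_, rfl⟩
  refine ⟨(idx.take d).flatMap (roundSchedule c),
    R ++ (idx.drop (d + 1)).flatMap (roundSchedule c), ?_, ?_, numReceived_flatMap_self hi _⟩
  · conv_lhs => rw [eq_take_append h]
    simp [hR]
  · rw [numReceived_flatMap hi, List.length_take, min_eq_left hd.le]

/-- The transmission of the bit number `b` of the letter sent to `j` in the round at depth `d`. -/
theorem exists_letter_step {c j : Fin k} (hj : j ≠ c) {idx : List (Fin k)} {d b : ℕ}
    (hd : d < idx.length) (hb : b < 4) :
    ∃ pre post, idx.flatMap (roundSchedule c) = pre ++ (c, j) :: post ∧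
      numReceived j pre = 4 * d + b ∧
      numReceived c pre = (idx.take (d + 1)).countP (· ≠ c) := by
  have h : idx[d]? = some idx[d] := List.getElem?_eq_getElem hd
  obtain ⟨A, B, hAB, h1, h2, h3, h4⟩ := roundSchedule_split hj idx[d]
  refine ⟨(idx.take d).flatMap (roundSchedule c) ++ (A ++ List.replicate b (c, j)),
    List.replicate (3 - b) (c, j) ++ B ++ (idx.drop (d + 1)).flatMap (roundSchedule c), ?_, ?_, ?_⟩
  · conv_lhs => rw [eq_take_append h]
    have : List.replicate 4 (c, j) =
        List.replicate b (c, j) ++ (c, j) :: List.replicate (3 - b) (c, j) := by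
      rw [← List.replicate_succ, List.replicate_append_replicate]
      congr 1; omega
    rw [List.flatMap_append, List.flatMap_cons, hAB, this]
    simp only [List.append_assoc, List.cons_append]
  · rw [numReceived_append, numReceived_append, numReceived_flatMap hj, h1, List.length_take,
      min_eq_left hd.le]
    simp [numReceived, List.countP_replicate]
  · rw [numReceived_append, numReceived_append, numReceived_flatMap_self hj, h3,
      List.take_succ_eq_append_getElem hd, List.countP_append]
    by_cases hc : idx[d] = c <;> simp [numReceived, hc, hj]

end Schedule

/-! ### Runs of protocols with a fixed schedule -/

namespace Protocol

variable {k : ℕ} {X : Fin k → Type u} {Y : Type v} (P : Protocol X Y)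

theorem view_concat (i : Fin k) (τ : List Bool) (b : Bool) :
    P.view i (τ ++ [b]) = P.view i τ ++ [observe i (P.next τ) b] := by
  rw [view, view, List.length_append, List.length_singleton, List.range_succ, List.map_append]
  congr 1
  · refine List.map_congr_left fun t ht => ?_
    have ht : t < τ.length := List.mem_range.1 ht
    rw [List.take_append_of_le_length ht.le, List.getD_append _ _ _ _ ht]
  · simp

theorem trace_eq_of_halts {x : ∀ i, X i} {e : ℕ → Bool} {n : ℕ} (h : P.Halts x e n) (m : ℕ) :
    P.trace x e (n + m) = P.trace x e n := by
  induction m with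
  | zero => rfl
  | succ m ih => rw [← add_assoc, trace, ih, h]

/-- The bits that `i` has received after `t` steps. -/
def received (x : ∀ i, X i) (e : ℕ → Bool) (i : Fin k) (t : ℕ) : List Bool :=
  receivedBits (P.view i (P.trace x e t))

variable {P} {S : List (Fin k × Fin k)}

theorem length_trace (hS : ∀ τ, P.next τ = S[τ.length]?)
    (x : ∀ i, X i) (e : ℕ → Bool) {t : ℕ} (ht : t ≤ S.length) :
    (P.trace x e t).length = t := by
  induction t with
  | zero => rfl
  | succ t ih =>
    have ih := ih (by omega)
    rw [trace, hS, ih, List.getElem?_eq_getElem (by omega)]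
    simp [ih]

theorem halts_iff (hS : ∀ τ, P.next τ = S[τ.length]?)
    (x : ∀ i, X i) (e : ℕ → Bool) {n : ℕ} : P.Halts x e n ↔ S.length ≤ n := by
  have hN : P.Halts x e S.length := by
    rw [Halts, hS, length_trace hS x e le_rfl]
    simp
  constructor
  · intro h
    by_contra! hlt
    rw [Halts, hS, length_trace hS x e hlt.le] at h
    simp at h
    omega
  · intro h
    obtain ⟨m, rfl⟩ := Nat.exists_eq_add_of_le h
    rw [Halts, P.trace_eq_of_halts hN m]
    exact hN

theorem trace_eq (hS : ∀ τ, P.next τ = S[τ.length]?)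
    (x : ∀ i, X i) (e : ℕ → Bool) {n : ℕ} (h : P.Halts x e n) :
    P.trace x e n = P.trace x e S.length := by
  obtain ⟨m, rfl⟩ := Nat.exists_eq_add_of_le ((halts_iff hS x e).1 h)
  exact P.trace_eq_of_halts ((halts_iff hS x e).2 le_rfl) m

theorem trace_succ (hS : ∀ τ, P.next τ = S[τ.length]?)
    (x : ∀ i, X i) (e : ℕ → Bool) {t : ℕ} {s r : Fin k} (ht : S[t]? = some (s, r)) :
    P.trace x e (t + 1) = P.trace x e t ++
      [xor (P.msg s (x s) (P.view s (P.trace x e t)) r) (e t)] := by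
  obtain ⟨h, -⟩ := List.getElem?_eq_some_iff.1 ht
  rw [trace, hS, length_trace hS x e h.le, ht]

theorem view_succ (hS : ∀ τ, P.next τ = S[τ.length]?)
    (x : ∀ i, X i) (e : ℕ → Bool) {t : ℕ} {s r : Fin k} (ht : S[t]? = some (s, r))
    (i : Fin k) : P.view i (P.trace x e (t + 1)) = P.view i (P.trace x e t) ++
      [observe i (some (s, r)) (xor (P.msg s (x s) (P.view s (P.trace x e t)) r) (e t))] := by
  obtain ⟨h, -⟩ := List.getElem?_eq_some_iff.1 ht
  rw [trace_succ hS x e ht, view_concat, hS, length_trace hS x e h.le, ht]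

theorem received_succ (hS : ∀ τ, P.next τ = S[τ.length]?)
    (x : ∀ i, X i) (e : ℕ → Bool) {t : ℕ} {s r : Fin k}
    (ht : S[t]? = some (s, r)) (i : Fin k) : P.received x e i (t + 1) = P.received x e i t ++
      if r = i then [xor (P.msg s (x s) (P.view s (P.trace x e t)) r) (e t)] else [] := by
  obtain ⟨h, -⟩ := List.getElem?_eq_some_iff.1 ht
  have hne : s ≠ r := P.next_ne (P.trace x e t) s r (by rw [hS, length_trace hS x e h.le, ht])
  rw [received, view_succ hS x e ht, receivedBits, List.filterMap_append]
  congr 1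
  by_cases hi : i = s
  · subst hi
    simp [observe, Ne.symm hne]
  · by_cases hr : i = r
    · subst hr
      simp [observe, hi]
    · simp [observe, hi, hr, Ne.symm hr]

theorem length_received (hS : ∀ τ, P.next τ = S[τ.length]?)
    (x : ∀ i, X i) (e : ℕ → Bool) (i : Fin k) {t : ℕ} (ht : t ≤ S.length) :
    (P.received x e i t).length = numReceived i (S.take t) := by
  induction t with
  | zero => rfl
  | succ t ih =>
    have h : S[t]? = some (S[t].1, S[t].2) := List.getElem?_eq_getElem (by omega)
    rw [received_succ hS x e h, List.length_append, ih (by omega),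
      List.take_succ_eq_append_getElem (by omega), numReceived_append]
    congr 1
    by_cases hr : S[t].2 = i <;> simp [numReceived, hr]

theorem received_prefix (hS : ∀ τ, P.next τ = S[τ.length]?)
    (x : ∀ i, X i) (e : ℕ → Bool) (i : Fin k) {t t' : ℕ} (h : t ≤ t')
    (ht' : t' ≤ S.length) : P.received x e i t <+: P.received x e i t' := by
  induction t', h using Nat.le_induction with
  | base => exact List.prefix_rfl
  | succ t' _ ih =>
    have h : S[t']? = some (S[t'].1, S[t'].2) := List.getElem?_eq_getElem (by omega)
    rw [received_succ hS x e h]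
    exact (ih (by omega)).trans (List.prefix_append _ _)

/-- As only `c` sends to `j`, its own count tells `c` which bit of which letter is due. -/
theorem numSent_view (hS : ∀ τ, P.next τ = S[τ.length]?)
    (x : ∀ i, X i) (e : ℕ → Bool) {c j : Fin k}
    (hc : ∀ s, (s, j) ∈ S → s = c) {t : ℕ} (ht : t ≤ S.length) :
    numSent j (P.view c (P.trace x e t)) = numReceived j (S.take t) := by
  induction t with
  | zero => rfl
  | succ t ih =>
    have h : S[t]? = some (S[t].1, S[t].2) := List.getElem?_eq_getElem (by omega)
    rw [view_succ hS x e h, numSent, List.countP_append, List.take_succ_eq_append_getElem (by omega),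
      numReceived_append, ← ih (by omega), numSent]
    congr 1
    by_cases hr : S[t].2 = j
    · have hs : S[t].1 = c := hc _ (hr ▸ List.getElem_mem _)
      simp [numReceived, observe, hs, hr]
    · by_cases hs : c = S[t].1
      · simp [numReceived, observe, hr, ← hs]
      · by_cases hr' : c = S[t].2
        · simp [numReceived, observe, hr, hr', show S[t].2 ≠ S[t].1 from hr' ▸ hs]
        · simp [numReceived, observe, hr, hs, hr']

theorem getD_received (hS : ∀ τ, P.next τ = S[τ.length]?)
    (x : ∀ i, X i) (e : ℕ → Bool) {pre post : List (Fin k × Fin k)} {s r : Fin k}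
    (h : S = pre ++ (s, r) :: post) :
    (P.received x e r S.length).getD (numReceived r pre) false =
      xor (P.msg s (x s) (P.view s (P.trace x e pre.length)) r) (e pre.length) := by
  have ht : S[pre.length]? = some (s, r) := by simp [h]
  have hlt : pre.length < S.length := by simp [h]
  have hlen := length_received hS x e r hlt.le
  have hpre : S.take pre.length = pre := by simp [h]
  rw [hpre] at hlen
  obtain ⟨z, hz⟩ := received_prefix hS x e r (Nat.succ_le_of_lt hlt) le_rfl
  rw [← hz, Nat.succ_eq_add_one, received_succ hS x e ht, if_pos rfl, List.append_assoc,
    List.getD_append_right _ _ _ _ hlen.le, hlen]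
  simp

end Protocol

/-! ### Correctness of the protocol -/

variable {k : ℕ} {X : Fin k → Type u} {Y : Type v}

theorem treeCodeProtocol_next (c : Fin k) (T : StrategyTree X Y) (idx : List (Fin k))
    (C : List Bool → Letter) (τ : List Bool) :
    (treeCodeProtocol c T idx C).next τ = (idx.flatMap (roundSchedule c))[τ.length]? := rfl

theorem treeCodeProtocol_correct {c j₀ : Fin k} (hj₀ : j₀ ≠ c) {f : (∀ i, X i) → Y} {l : ℕ}
    {T : StrategyTree X Y} {idx : List (Fin k)} {C : List Bool → Letter}
    (hs : T.IsSemiStatic idx) (hT : T.Wins f l) (hC : IsTreeCode C (1 / 2) idx.length) :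
    (treeCodeProtocol c T idx C).ProofAgainst f (l / 4) := by
  classical
  intro x e n hn he
  have hS := treeCodeProtocol_next c T idx C
  generalize hPdef : treeCodeProtocol c T idx C = P at hn he hS ⊢
  generalize hSdef : idx.flatMap (roundSchedule c) = S at hS
  have hrecv : ∀ j ≠ c, (P.received x e j S.length).length = 4 * idx.length := by
    intro j hj
    rw [Protocol.length_received hS x e j le_rfl, List.take_length, ← hSdef,
      numReceived_flatMap hj]
  have hrecvc : (P.received x e c S.length).length = idx.countP (· ≠ c) := by
    rw [Protocol.length_received hS x e c le_rfl, List.take_length, ← hSdef,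
      numReceived_flatMap_self hj₀]
  obtain ⟨w, hw⟩ : ∃ w, w = T.track c (x c) (P.received x e c S.length) := ⟨_, rfl⟩
  have hwl : w.length = idx.length := by
    refine le_antisymm (hw ▸ T.length_track_le c (x c) idx _ hs) (hw ▸ ?_)
    exact T.le_length_track c (x c) idx _ _ hs le_rfl (by rw [List.take_length, hrecvc])
  have hanswer : ∀ d i, idx[d]? = some i → i ≠ c → ∃ pre post, S = pre ++ (i, c) :: post ∧
      numReceived i pre = 4 * d ∧ w.getD d false = xor (T.answer i (x i)
        (decode C ((P.received x e i S.length).take (4 * d)))) (e pre.length) := by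
    intro d i hi hic
    obtain ⟨pre, post, h, h1, h2⟩ := exists_answer_step hi hic
    rw [hSdef] at h
    refine ⟨pre, post, h, h1, ?_⟩
    obtain ⟨hd, -⟩ := List.getElem?_eq_some_iff.1 hi
    have hlt : pre.length ≤ S.length := by simp [h]
    have hpl : (P.received x e i pre.length).length = 4 * d := by
      rw [Protocol.length_received hS x e i hlt, ← h1]
      simp [h]
    have hpre : P.received x e i pre.length = (P.received x e i S.length).take (4 * d) := by
      rw [List.prefix_iff_eq_take.1 (Protocol.received_prefix hS x e i hlt le_rfl), hpl]
    rw [hw, T.getD_track_of_ne c (x c) idx _ d i hs hi hic (by rw [← hw, hwl]; exact hd), ← h2,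
      Protocol.getD_received hS x e h, ← hpre, ← hPdef]
    simp only [treeCodeProtocol, dif_neg hic]
    rfl
  have hletter : ∀ j ≠ c, ∀ d < idx.length, ∀ b : Fin 4, ∃ pre post, S = pre ++ (c, j) :: post ∧
      numReceived j pre = 4 * d + b ∧ (P.received x e j S.length).getD (4 * d + b) false =
        xor (C (w.take (d + 1)) b) (e pre.length) := by
    intro j hj d hd b
    obtain ⟨pre, post, h, h1, h2⟩ := exists_letter_step hj hd b.2
    rw [hSdef] at h
    refine ⟨pre, post, h, h1, ?_⟩
    have hlt : pre.length ≤ S.length := by simp [h]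
    have hpre : S.take pre.length = pre := by simp [h]
    have hsent : numSent j (P.view c (P.trace x e pre.length)) = 4 * d + b := by
      rw [Protocol.numSent_view hS x e (fun s hs => eq_of_mem_flatMap_roundSchedule
        (hSdef ▸ hs) hj) hlt, hpre, h1]
    -- The answer of round `d` precedes its letters, so the state of `c` already has depth `d + 1`.
    have hlen : d + 1 ≤ (T.track c (x c) (P.received x e c pre.length)).length := by
      refine T.le_length_track c (x c) idx _ _ hs hd ?_
      rw [← h2, Protocol.length_received hS x e c hlt, hpre]
    have htake : (T.track c (x c) (P.received x e c pre.length)).take (d + 1) =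
        w.take (d + 1) := by
      obtain ⟨more, hmore⟩ := Protocol.received_prefix hS x e c hlt le_rfl
      obtain ⟨z, hz⟩ := T.track_prefix c (x c) more (P.received x e c pre.length)
      rw [hw, ← hmore, ← hz, List.take_append_of_le_length hlen]
    rw [← h1, Protocol.getD_received hS x e h]
    congr 1
    have hmsg : ∀ u : List (Observation k), P.msg c (x c) u j =
        C ((T.track c (x c) (receivedBits u)).take (numSent j u / 4 + 1))
          ⟨numSent j u % 4, Nat.mod_lt _ (by norm_num)⟩ := by
      intro u
      rw [← hPdef]
      simp only [treeCodeProtocol, dif_pos]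
    rw [hmsg, ← htake]
    have e1 : numSent j (P.view c (P.trace x e pre.length)) / 4 = d := by omega
    have e2 : (⟨numSent j (P.view c (P.trace x e pre.length)) % 4,
        Nat.mod_lt _ (by norm_num)⟩ : Fin 4) = b := Fin.ext (by simp only; omega)
    rw [e1, e2]
    rfl
  have key := values_eq_of_errors_le hs hT hC x hwl
    (r := fun j => P.received x e j S.length) hrecv
    (fun d hd hi => by
      rw [hw]
      exact T.getD_track_self c (x c) idx _ d hs hi (by rw [← hw, hwl]; exact hd))
    -- The errors are sorted by receiver: inverted letter bits for `j ≠ c`, inverted answers for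
    -- `c`.
    (E := fun j => ((range S.length).filter fun t =>
      e t = true ∧ ∃ s, S[t]? = some (s, j)).card)
    (by
      intro j hj
      -- Every wrong letter contains an inverted bit, whose position among the bits received by `j`,
      -- divided by 4, gives back the letter.
      refine le_trans (card_le_card (t := (((range S.length).filter fun t =>
        e t = true ∧ ∃ s, S[t]? = some (s, j))).image
          fun t => numReceived j (S.take t) / 4) fun d hd => ?_) card_image_le
      rw [mem_filter, mem_range] at hd
      obtain ⟨hd, hne⟩ := hd
      obtain ⟨b, hb⟩ := Function.ne_iff.1 hne
      obtain ⟨pre, post, h, h1, h2⟩ := hletter j hj d hd b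
      refine mem_image.2 ⟨pre.length, mem_filter.2 ⟨by simp [h], ?_, c, by simp [h]⟩, ?_⟩
      · rw [letterAt, h2] at hb
        by_contra hcon
        exact hb (by rw [Bool.eq_false_of_not_eq_true hcon, Bool.xor_false])
      · rw [show S.take pre.length = pre by simp [h], h1]
        omega)
    (by
      -- The depth of an inverted answer is recovered from its sender, which has received four bits
      -- per earlier round.
      refine le_trans (card_le_card (t := (((range S.length).filter fun t =>
        e t = true ∧ ∃ s, S[t]? = some (s, c))).image fun t =>
          match S[t]? with
          | some (s, _) => numReceived s (S.take t) / 4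
          | none => 0) fun d hd => ?_) card_image_le
      obtain ⟨-, i, hic, hi, hne⟩ := mem_filter.1 hd
      obtain ⟨pre, post, h, h1, h2⟩ := hanswer d i hi hic
      have ht : S[pre.length]? = some (i, c) := by simp [h]
      refine mem_image.2 ⟨pre.length, mem_filter.2 ⟨by simp [h], ?_, i, ht⟩, ?_⟩
      · rw [h2] at hne
        by_contra hcon
        exact hne (by rw [Bool.eq_false_of_not_eq_true hcon, Bool.xor_false])
      · rw [ht]
        simp only
        rw [show S.take pre.length = pre by simp [h], h1]
        omega)
    (by
      have herr : ∑ j, ((range S.length).filter fun t =>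
          e t = true ∧ ∃ s, S[t]? = some (s, j)).card ≤ P.errors x e n := by
        rw [← card_biUnion, Protocol.errors, Protocol.trace_eq hS x e hn,
          Protocol.length_trace hS x e le_rfl]
        · refine card_le_card fun t ht => ?_
          obtain ⟨j, -, hj⟩ := mem_biUnion.1 ht
          rw [mem_filter] at hj ⊢
          exact ⟨hj.1, hj.2.1⟩
        -- Each transmission has only one receiver.
        · intro j _ j' _ hjj'
          refine disjoint_left.2 fun t ht ht' => hjj' ?_
          obtain ⟨-, -, s, h⟩ := mem_filter.1 ht
          obtain ⟨-, -, s', h'⟩ := mem_filter.1 ht'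
          rw [h] at h'
          exact (Prod.mk.inj (Option.some.inj h')).2
      omega)
  intro i
  rw [Protocol.trace_eq hS x e hn]
  by_cases hi : i = c
  · subst hi
    rw [← key.1, hw, ← hPdef]
    simp only [treeCodeProtocol, dif_pos]
    rfl
  · rw [← key.2 i hi, ← hPdef]
    simp only [treeCodeProtocol, dif_neg hi]
    rfl

/-! ### Number of exchanged bits and fraction of errors -/

theorem treeCodeProtocol_exchangesAtMost (c : Fin k) (T : StrategyTree X Y) {idx : List (Fin k)}
    (C : List Bool → Letter) {q : ℕ} (h : idx.length ≤ k * q) :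
    (treeCodeProtocol c T idx C).ExchangesAtMost (k * (4 * k - 3) * q) := by
  intro x e
  rw [Protocol.halts_iff (treeCodeProtocol_next c T idx C)]
  calc _ ≤ (4 * k - 3) * idx.length := length_flatMap_roundSchedule_le c idx
    _ ≤ (4 * k - 3) * (k * q) := Nat.mul_le_mul_left _ h
    _ = _ := by ring

theorem Protocol.ProofAgainst.fraction {P : Protocol X Y} {f : (∀ i, X i) → Y} {l N : ℕ} {ε : ℝ}
    (h : P.ProofAgainst f l) (hN : P.ExchangesAtMost N) (hε : 0 ≤ ε) (hl : ε * N < l + 1) :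
    P.ProofAgainstFraction f ε := by
  intro x e n hn he
  refine h x e n hn ?_
  have hstab : ∀ m m', P.Halts x e m → P.trace x e (m + m') = P.trace x e m :=
    fun m m' hm => P.trace_eq_of_halts hm m'
  have hle : ∀ m, (P.trace x e m).length ≤ m := by
    intro m
    induction m with
    | zero => simp [Protocol.trace]
    | succ m ih =>
      rw [Protocol.trace]
      split
      · omega
      · simpa using ih
  have hlen : (P.trace x e n).length ≤ N := by
    -- The run has ended both at `n` and at `N`; the two traces are compared at `n + N`.
    rw [← hstab n N hn, add_comm, hstab N n (hN x e)]
    exact hle N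
  have h1 : (P.errors x e n : ℝ) < ((l + 1 : ℕ) : ℝ) := by
    push_cast
    refine (he.trans (mul_le_mul_of_nonneg_left ?_ hε)).trans_lt hl
    exact_mod_cast hlen
  exact Nat.lt_succ_iff.1 (Nat.cast_lt.1 h1)

theorem PaulWins.exists_semiStatic_treeCode {f : (∀ i, X i) → Y} {q l : ℕ} (h : PaulWins f q l) :
    ∃ (idx : List (Fin k)) (T : StrategyTree X Y) (C : List Bool → Letter),
      idx.length ≤ k * q ∧ T.IsSemiStatic idx ∧ T.Wins f l ∧ IsTreeCode C (1 / 2) idx.length := by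
  obtain ⟨T, hq, hT⟩ := h
  obtain ⟨T', h1, h2⟩ := StrategyTree.exists_semiStatic q T hq
  obtain ⟨C, hC⟩ := exists_isTreeCode (List.replicate q (List.finRange k)).flatten.length
  refine ⟨_, T', C, le_of_eq ?_, h2, h1.wins hT, hC⟩
  simp [mul_comm]

end UlamGame

/-! ### The main theorem -/

theorem mainTheorem2 {k : ℕ} (hk : 2 ≤ k) {X : Fin k → Type u} [∀ i, Nonempty (X i)] {Y : Type v}
    (f : (∀ i, X i) → Y) :
    -- the equivalence
    (∀ l : ℕ, (∃ q, UlamGame.PaulWins f q l) ↔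
      ∃ P : UlamGame.Protocol X Y, (∃ n, P.ExchangesAtMost n) ∧ P.ProofAgainst f l) ∧
    -- from a protocol to a winning strategy
    (∀ (q l : ℕ) (P : UlamGame.Protocol X Y), P.ExchangesAtMost q → P.ProofAgainst f l →
      UlamGame.PaulWins f q l) ∧
    -- from a winning strategy to a protocol
    (∀ q l : ℕ, UlamGame.PaulWins f q l →
      -- a semi-static winning strategy of depth at most `k * q` and a tree code for it exist
      (∃ (idx : List (Fin k)) (T : UlamGame.StrategyTree X Y) (C : List Bool → UlamGame.Letter),
        idx.length ≤ k * q ∧ T.IsSemiStatic idx ∧ T.Wins f l ∧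
          UlamGame.IsTreeCode C (1 / 2) idx.length) ∧
      -- and any such give a robust protocol
      (∀ (idx : List (Fin k)) (T : UlamGame.StrategyTree X Y) (C : List Bool → UlamGame.Letter),
        idx.length ≤ k * q → T.IsSemiStatic idx → T.Wins f l →
          UlamGame.IsTreeCode C (1 / 2) idx.length →
          ∃ P : UlamGame.Protocol X Y,
            P = UlamGame.treeCodeProtocol ⟨0, by omega⟩ T idx C ∧
            P.FixedSchedule ∧
            P.ExchangesAtMost (k * (4 * k - 3) * q) ∧
            P.ProofAgainst f (l / 4) ∧
            P.ProofAgainstFraction f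
              ((l : ℝ) / (4 * (k : ℝ) * (4 * (k : ℝ) - 3) * (q : ℝ))))) := by
  have hj₀ : (⟨1, by omega⟩ : Fin k) ≠ ⟨0, by omega⟩ := by simp
  refine ⟨fun l => ⟨?_, ?_⟩, fun q l P => P.paulWins_of_proofAgainst hk, fun q l h =>
    ⟨h.exists_semiStatic_treeCode, fun idx T C hidx hs hT hC => ?_⟩⟩
  · rintro ⟨q, h⟩
    -- The protocol loses a factor 4, so a strategy against `4 * l` lies is needed.
    obtain ⟨q', h'⟩ := h.exists_of_any (4 * l)
    obtain ⟨idx, T, C, hidx, hs, hT, hC⟩ := h'.exists_semiStatic_treeCode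
    refine ⟨_, ⟨_, UlamGame.treeCodeProtocol_exchangesAtMost ⟨0, by omega⟩ T C hidx⟩, ?_⟩
    have := UlamGame.treeCodeProtocol_correct hj₀ hs hT hC
    rwa [Nat.mul_div_cancel_left l (by norm_num)] at this
  · rintro ⟨P, ⟨n, hn⟩, hP⟩
    exact ⟨n, P.paulWins_of_proofAgainst hk hn hP⟩
  · have hcorrect := UlamGame.treeCodeProtocol_correct hj₀ hs hT hC
    have hbits := UlamGame.treeCodeProtocol_exchangesAtMost ⟨0, by omega⟩ T C hidx
    refine ⟨_, rfl, fun τ τ' hτ => ?_, hbits, hcorrect, hcorrect.fraction hbits ?_ ?_⟩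
    · rw [UlamGame.treeCodeProtocol_next, UlamGame.treeCodeProtocol_next, hτ]
    · have : (2 : ℝ) ≤ k := by exact_mod_cast hk
      have : (0 : ℝ) ≤ 4 * (k : ℝ) - 3 := by linarith
      positivity
    · have hk' : (2 : ℝ) ≤ k := by exact_mod_cast hk
      have h3 : (0 : ℝ) < 4 * (k : ℝ) - 3 := by linarith
      have hcast : ((k * (4 * k - 3) * q : ℕ) : ℝ) = k * (4 * k - 3) * q := by
        rw [Nat.cast_mul, Nat.cast_mul, Nat.cast_sub (by omega)]
        push_cast
        ring
      -- For `q > 0` the fraction times the bound on the bits is exactly `l / 4`, while the number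
      -- of errors is an integer; for `q = 0` the product is `0`.
      have hdiv : (l : ℝ) / 4 < (l / 4 : ℕ) + 1 := by
        rw [div_lt_iff₀ (by norm_num)]
        exact_mod_cast (by omega : l < (l / 4 + 1) * 4)
      rw [hcast]
      rcases Nat.eq_zero_or_pos q with rfl | hq
      · simp
        positivity
      · have hq' : (0 : ℝ) < q := by exact_mod_cast hq
        convert hdiv using 1
        field_simp
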